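/- Let $\alpha>0$ and let $\gamma\subset\mathbb{C}$ be a Jordan arc of class $C^{3+\alpha}$ with endpoints $p\neq q$ (for instance $p=-1$, $q=1$); that is, $\gamma=w([-1,1])$ for some injective $C^3$ map $w:[-1,1]\to\mathbb{C}$ with $w(-1)=p$, $w(1)=q$, $w'\neq 0$ on $[-1,1]$ and $w'''$ Hölder continuous with exponent $\alpha$. Let $\nu_e$ be the equilibrium measure of $\gamma$, i.e. the probability measure on $\gamma$ that minimizes the logarithmic energy $I[\mu]=\iint\log|z-w|^{-1}\,d\mu(z)\,d\mu(w)$, let $\mathrm{cap}(\gamma)=e^{-I[\nu_e]}$, and let $z_e:[-1,1]\to\gamma$ be the equilibrium parametrization: the homeomorphism onto $\gamma$ with $z_e(-1)=p$, $z_e(1)=q$ and $$\nu_e(z_e([-1,t]))=\frac1\pi\int_{-1}^t\frac{ds}{\sqrt{1-s^2}},\qquad -1\le t\le 1 .$$ The arc-Grunsky coefficients $a_{kl}\in\mathbb{R}$, $k,l\ge 1$, of $\gamma$ are the coefficients in the expansion $$\log\Big|\frac{z_e(s)-z_e(t)}{s-t}\Big|=\log(2\,\mathrm{cap}(\gamma))-2\sum_{k,l\ge1}a_{kl}T_k(s)T_l(t),$$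 uniform in $s,t\in[-1,1]$, where $T_k$ is the $k$-th Chebyshev polynomial of the first kind; they are given by $$a_{kl}=-\frac{2}{\pi^2}\int_0^\pi\!\!\int_0^\pi\log\Big|\frac{z_e(\cos\theta)-z_e(\cos\phi)}{\cos\theta-\cos\phi}\Big|\cos(k\theta)\cos(l\phi)\,d\phi\,d\theta .$$ Let $b_{kl}=\sqrt{kl}\,a_{kl}$ and let $B$ be the arc-Grunsky operator, i.e. the operator on (real or complex) $\ell^2(\mathbb{Z}_+)$ given by multiplication by the matrix $(b_{kl})_{k,l\ge1}$. Then $$B\ge -I .$$ That is, $\sum_{k,l}(\delta_{kl}+b_{kl})x_kx_l\ge0$ for all finitely supported real sequences $(x_k)_{k\ge1}$, the operator $I+B$ is symmetric and positive semidefinite on $\ell^2(\mathbb{Z}_+)$, and all eigenvalues of $B$ are real and greater than or equal to $-1$. -/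

import Mathlib

open MeasureTheory Set Filter Topology

noncomputable section

namespace ArcGrunsky

/-- `γ` is a Jordan arc of class `C^{m+α}` from `p` to `q`: the image of `[-1, 1]` under an injective
regular parametrization of class `C^m` whose `m`-th derivative is `α`-Hölder on `[-1, 1]`. -/
def IsHolderJordanArc (m : ℕ) (α : ℝ) (p q : ℂ) (γ : Set ℂ) : Prop :=
  ∃ w : ℝ → ℂ,
    ContDiffOn ℝ m w (Icc (-1) 1) ∧
    (∃ C : ℝ, ∀ s ∈ Icc (-1 : ℝ) 1, ∀ t ∈ Icc (-1 : ℝ) 1,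
      ‖iteratedDerivWithin m w (Icc (-1) 1) s - iteratedDerivWithin m w (Icc (-1) 1) t‖
        ≤ C * |s - t| ^ α) ∧
    (∀ t ∈ Icc (-1 : ℝ) 1, derivWithin w (Icc (-1) 1) t ≠ 0) ∧
    InjOn w (Icc (-1) 1) ∧
    w (-1) = p ∧ w 1 = q ∧
    w '' Icc (-1) 1 = γ

/-- The kernel `log (1 / |z - w|)`, with the value `+∞` on the diagonal. -/
def logKernel (z w : ℂ) : EReal := -ENNReal.log (edist z w)

/-- The logarithmic energy `∫∫ log (1 / |z - w|) dμ(z) dμ(w)` with values in the extended reals, as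
the integral of the positive part minus that of the negative part. For a finite measure on a compact
set the latter is finite, so the energy is then well defined in `(-∞, +∞]`. -/
def logEnergy (μ : Measure ℂ) : EReal :=
  ((∫⁻ z, ∫⁻ w, (logKernel z w).toENNReal ∂μ ∂μ : ENNReal) : EReal) -
    ((∫⁻ z, ∫⁻ w, (-logKernel z w).toENNReal ∂μ ∂μ : ENNReal) : EReal)

/-- `μ` is a probability measure on `K`. -/
def IsProbabilityOn (K : Set ℂ) (μ : Measure ℂ) : Prop :=
  IsProbabilityMeasure μ ∧ μ Kᶜ = 0

/-- `ν` is an equilibrium measure of `K`: a minimizer of the logarithmic energy among all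
probability measures on `K`. -/
def IsEquilibriumMeasure (K : Set ℂ) (ν : Measure ℂ) : Prop :=
  IsProbabilityOn K ν ∧ ∀ μ : Measure ℂ, IsProbabilityOn K μ → logEnergy ν ≤ logEnergy μ

/-- The logarithmic capacity: `e^{-I}`, `I` the minimal logarithmic energy. -/
def logCapacity (K : Set ℂ) : ℝ :=
  (EReal.exp (-(⨅ (μ : Measure ℂ) (_ : IsProbabilityOn K μ), logEnergy μ))).toReal

/-- `z` (restricted to `[-1, 1]`) is the equilibrium parametrization of the arc `γ` from `p` to `q`:
it carries the equilibrium measure of `[-1, 1]` to that of `γ`. -/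
def IsEquilibriumParametrization (p q : ℂ) (γ : Set ℂ) (z : ℝ → ℂ) : Prop :=
  ContinuousOn z (Icc (-1) 1) ∧ InjOn z (Icc (-1) 1) ∧ z '' Icc (-1) 1 = γ ∧
    z (-1) = p ∧ z 1 = q ∧
    ∃ ν : Measure ℂ, IsEquilibriumMeasure γ ν ∧ ∀ t ∈ Icc (-1 : ℝ) 1,
      ν (z '' Icc (-1) t) =
        ENNReal.ofReal (1 / Real.pi * ∫ s in (-1 : ℝ)..t, 1 / Real.sqrt (1 - s ^ 2))

/-- The real numbers `a k l`, `k, l ≥ 1`, are the coefficients of an arc-Grunsky expansion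
`log |(z s - z t) / (s - t)| = log (2 cap γ) - 2 ∑ a k l T_k(s) T_l(t)`,
converging uniformly in `s, t ∈ [-1, 1]` (off the diagonal, where the quotient is defined). -/
def IsArcGrunskyExpansion (γ : Set ℂ) (z : ℝ → ℂ) (a : ℕ+ → ℕ+ → ℝ) : Prop :=
  ∃ S : ℝ × ℝ → ℝ,
    HasSumUniformlyOn
      (fun (kl : ℕ+ × ℕ+) (st : ℝ × ℝ) =>
        a kl.1 kl.2 * (Polynomial.Chebyshev.T ℝ (kl.1 : ℕ)).eval st.1 *
          (Polynomial.Chebyshev.T ℝ (kl.2 : ℕ)).eval st.2)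
      S {st | st.1 ∈ Icc (-1) 1 ∧ st.2 ∈ Icc (-1) 1 ∧ st.1 ≠ st.2} ∧
    ∀ s ∈ Icc (-1 : ℝ) 1, ∀ t ∈ Icc (-1 : ℝ) 1, s ≠ t →
      Real.log ‖(z s - z t) / ((s : ℂ) - (t : ℂ))‖
        = Real.log (2 * logCapacity γ) - 2 * S (s, t)

/-- The arc-Grunsky coefficients of the equilibrium parametrization `z`, as the Chebyshev
coefficients of `log |(z s - z t) / (s - t)|` (here `s = cos θ`, `t = cos φ`). -/
def arcGrunskyCoeff (z : ℝ → ℂ) (k l : ℕ+) : ℝ :=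
  -(2 / Real.pi ^ 2) * ∫ θ in (0 : ℝ)..Real.pi, ∫ φ in (0 : ℝ)..Real.pi,
    Real.log ‖(z (Real.cos θ) - z (Real.cos φ)) / ((Real.cos θ : ℂ) - (Real.cos φ : ℂ))‖ *
      Real.cos ((k : ℕ) * θ) * Real.cos ((l : ℕ) * φ)

/-- The entries `b k l = √(k l) a k l` of the arc-Grunsky matrix. -/
def arcGrunskyMatrix (z : ℝ → ℂ) (k l : ℕ+) : ℝ :=
  Real.sqrt (((k : ℕ) : ℝ) * ((l : ℕ) : ℝ)) * arcGrunskyCoeff z k l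

/-- `B` is the arc-Grunsky operator on `ℓ²(ℤ₊)`: the action of the arc-Grunsky matrix by matrix
multiplication. -/
def IsArcGrunskyOperator {𝕜 : Type*} [RCLike 𝕜] (z : ℝ → ℂ)
    (B : lp (fun _ : ℕ+ => 𝕜) 2 →ₗ[𝕜] lp (fun _ : ℕ+ => 𝕜) 2) : Prop :=
  ∀ (x : lp (fun _ : ℕ+ => 𝕜) 2) (k : ℕ+),
    HasSum (fun l : ℕ+ => (arcGrunskyMatrix z k l : 𝕜) * x l) (B x k)

end ArcGrunsky

end

/-!
The entries of `I + B` are `-2 √(kl)` times the cosine coefficients of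
`log |z(cos θ) - z(cos φ)|`: the cosines diagonalize the kernel `log |cos θ - cos φ|` of the
segment, whose coefficients `-1/(2k)` account exactly for the identity. Positivity of `I + B` thus
says that the logarithmic kernel is negative on real densities of total mass zero on the arc. It
is, because the kernel is, up to a constant, minus a mixture of Gaussians by a Frullani integral,
and Gaussians have positive Fourier transform. The double integrals converge because the
equilibrium measure, which is the image of `dθ / π` under `z ∘ cos`, has finite energy: some
probability measure on the arc does, namely one for which the distance to an endpoint follows
the arcsine law.
-/

namespace ArcGrunsky

section ConditionallyPositiveDefinite

variable {Ω : Type*} [MeasurableSpace Ω] {μ : Measure Ω} {f : Ω → ℝ}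
  {V : Type*} [NormedAddCommGroup V] [InnerProductSpace ℝ V]

lemma exp_neg_mul_sq_norm_sub_mul (t : ℝ) (v w u : V) :
    Real.exp (-(2 * t) * ‖v - u‖ ^ 2) * Real.exp (-(2 * t) * ‖w - u‖ ^ 2) =
      Real.exp (-t * ‖v - w‖ ^ 2) * Real.exp (-(4 * t) * ‖u - (1 / 2 : ℝ) • (v + w)‖ ^ 2) := by
  have parallelogram := parallelogram_law_with_norm ℝ (v - u) (w - u)
  have hsum : v - u + (w - u) = (-2 : ℝ) • (u - (1 / 2 : ℝ) • (v + w)) := by module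
  rw [hsum, sub_sub_sub_cancel_right, norm_smul, Real.norm_eq_abs, abs_neg, abs_two]
    at parallelogram
  rw [← Real.exp_add, ← Real.exp_add]
  congr 1
  linear_combination t * parallelogram

variable [FiniteDimensional ℝ V] [MeasurableSpace V] [BorelSpace V]

lemma integrable_exp_neg_mul_sq_norm {b : ℝ} (hb : 0 < b) :
    Integrable fun v : V => Real.exp (-b * ‖v‖ ^ 2) := by
  have h := GaussianFourier.integrable_cexp_neg_mul_sq_norm_add (V := V) (b := (b : ℂ))
    (by simpa using hb) 0 0
  refine h.norm.congr (Eventually.of_forall fun v => ?_)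
  simp [Complex.norm_exp, ← Complex.ofReal_pow]

lemma integrable_exp_neg_mul_sq_norm_sub_mul {t : ℝ} (ht : 0 < t) (v w : V) :
    Integrable fun u : V =>
      Real.exp (-(2 * t) * ‖v - u‖ ^ 2) * Real.exp (-(2 * t) * ‖w - u‖ ^ 2) := by
  simp_rw [exp_neg_mul_sq_norm_sub_mul]
  exact ((integrable_exp_neg_mul_sq_norm (by positivity : 0 < 4 * t)).comp_sub_right _).const_mul _

lemma integral_exp_neg_mul_sq_norm_sub_mul (t : ℝ) (v w : V) :
    ∫ u : V, Real.exp (-(2 * t) * ‖v - u‖ ^ 2) * Real.exp (-(2 * t) * ‖w - u‖ ^ 2) =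
      Real.exp (-t * ‖v - w‖ ^ 2) * ∫ u : V, Real.exp (-(4 * t) * ‖u‖ ^ 2) := by
  simp_rw [exp_neg_mul_sq_norm_sub_mul]
  rw [integral_const_mul,
    integral_sub_right_eq_self (fun u : V => Real.exp (-(4 * t) * ‖u‖ ^ 2))]

variable {Z : Ω → V}

lemma integrable_mul_mul_exp_neg_mul_sq_norm_sub (hZ : Measurable Z) (hf : Integrable f μ)
    {t : ℝ} (ht : 0 ≤ t) :
    Integrable (fun p : Ω × Ω => f p.1 * f p.2 * Real.exp (-t * ‖Z p.1 - Z p.2‖ ^ 2))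
      (μ.prod μ) := by
  refine (hf.mul_prod hf).mul_bdd (c := 1) (by fun_prop) (Eventually.of_forall fun p => ?_)
  rw [Real.norm_eq_abs, Real.abs_exp, Real.exp_le_one_iff]
  nlinarith [sq_nonneg ‖Z p.1 - Z p.2‖]

variable [SFinite μ]

/-- A product of Gaussians in `u` integrates to a Gaussian in `v - w`, so the energy is an integral
of squares. -/
lemma integral_mul_mul_exp_neg_mul_sq_norm_sub_nonneg (hZ : Measurable Z) (hf : Integrable f μ)
    {t : ℝ} (ht : 0 < t) :
    0 ≤ ∫ p : Ω × Ω, f p.1 * f p.2 * Real.exp (-t * ‖Z p.1 - Z p.2‖ ^ 2) ∂(μ.prod μ) := by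
  let g : V → Ω → ℝ := fun u x => f x * Real.exp (-(2 * t) * ‖Z x - u‖ ^ 2)
  have hg (p : Ω × Ω) (u : V) : g u p.1 * g u p.2 = f p.1 * f p.2 *
      (Real.exp (-(2 * t) * ‖Z p.1 - u‖ ^ 2) * Real.exp (-(2 * t) * ‖Z p.2 - u‖ ^ 2)) := by
    simp only [g]
    ring
  have hint : Integrable (fun q : (Ω × Ω) × V => g q.2 q.1.1 * g q.2 q.1.2)
      ((μ.prod μ).prod volume) := by
    simp only [hg]
    refine (integrable_prod_iff ?_).2 ⟨Eventually.of_forall fun p => ?_, ?_⟩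
    · exact (hf.mul_prod hf).aestronglyMeasurable.comp_fst.mul (by fun_prop)
    · exact (integrable_exp_neg_mul_sq_norm_sub_mul ht (Z p.1) (Z p.2)).const_mul (f p.1 * f p.2)
    · simp only [norm_mul, Real.norm_eq_abs, Real.abs_exp, integral_const_mul,
        integral_exp_neg_mul_sq_norm_sub_mul]
      simpa only [norm_mul, Real.norm_eq_abs, Real.abs_exp, mul_assoc] using
        (integrable_mul_mul_exp_neg_mul_sq_norm_sub hZ hf ht.le).norm.mul_const
          (∫ u : V, Real.exp (-(4 * t) * ‖u‖ ^ 2))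
  have hmass : 0 < ∫ u : V, Real.exp (-(4 * t) * ‖u‖ ^ 2) := by
    rw [GaussianFourier.integral_rexp_neg_mul_sq_norm (by positivity)]
    positivity
  refine nonneg_of_mul_nonneg_left ?_ hmass
  calc 0 ≤ ∫ u : V, (∫ x, g u x ∂μ) * ∫ x, g u x ∂μ := integral_nonneg fun u => mul_self_nonneg _
    _ = ∫ u : V, ∫ p : Ω × Ω, g u p.1 * g u p.2 ∂(μ.prod μ) := by simp only [integral_prod_mul]
    _ = ∫ p : Ω × Ω, (∫ u : V, g u p.1 * g u p.2) ∂(μ.prod μ) := (integral_integral_swap hint).symm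
    _ = _ := by
      simp only [hg, integral_const_mul, integral_exp_neg_mul_sq_norm_sub_mul]
      simp only [← mul_assoc, integral_mul_const]

/-- The integrand of Frullani's integral `∫₀^∞ (e^{-at} - e^{-t}) / t dt = -log a`. -/
noncomputable def frullaniExp (a t : ℝ) : ℝ := t⁻¹ * (Real.exp (-(a * t)) - Real.exp (-(1 * t)))

lemma measurable_frullaniExp : Measurable (Function.uncurry frullaniExp) := by
  unfold frullaniExp Function.uncurry
  fun_prop

lemma frullaniExp_nonneg {a t : ℝ} (ha : a ≤ 1) (ht : 0 < t) : 0 ≤ frullaniExp a t :=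
  mul_nonneg (inv_nonneg.2 ht.le) (sub_nonneg.2 (Real.exp_le_exp.2 (by gcongr)))

lemma frullaniExp_nonpos {a t : ℝ} (ha : 1 ≤ a) (ht : 0 < t) : frullaniExp a t ≤ 0 :=
  mul_nonpos_of_nonneg_of_nonpos (inv_nonneg.2 ht.le) (sub_nonpos.2 (Real.exp_le_exp.2 (by gcongr)))

lemma abs_frullaniExp_le {a t : ℝ} (ht : 0 < t) :
    |frullaniExp a t| ≤ |a - 1| * Real.exp (-(min a 1) * t) := by
  have exp_sub_exp_le (x y : ℝ) : Real.exp (-(x * t)) - Real.exp (-(y * t)) ≤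
      (y - x) * t * Real.exp (-x * t) := by
    have hexp : Real.exp (-(y * t)) = Real.exp (-(x * t)) * Real.exp (-((y - x) * t)) := by
      rw [← Real.exp_add]
      ring_nf
    have := Real.add_one_le_exp (-((y - x) * t))
    rw [neg_mul x t, hexp]
    nlinarith [Real.exp_pos (-(x * t))]
  rcases le_total a 1 with ha | ha
  · rw [abs_of_nonneg (frullaniExp_nonneg ha ht), min_eq_left ha, abs_of_nonpos (by linarith),
      frullaniExp, inv_mul_le_iff₀ ht]
    linarith [exp_sub_exp_le a 1]
  · rw [abs_of_nonpos (frullaniExp_nonpos ha ht), min_eq_right ha, abs_of_nonneg (by linarith),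
      frullaniExp, ← mul_neg, inv_mul_le_iff₀ ht]
    linarith [exp_sub_exp_le 1 a]

lemma integrableOn_frullaniExp {a : ℝ} (ha : 0 < a) : IntegrableOn (frullaniExp a) (Ioi 0) := by
  refine Integrable.mono' ((exp_neg_integrableOn_Ioi 0 (lt_min ha one_pos)).const_mul |a - 1|)
    (measurable_frullaniExp.comp measurable_prodMk_left).aestronglyMeasurable ?_
  filter_upwards [ae_restrict_mem measurableSet_Ioi] with t ht
  exact abs_frullaniExp_le ht

lemma integral_frullaniExp {a : ℝ} (ha : 0 < a) :
    ∫ t in Ioi (0 : ℝ), frullaniExp a t = -Real.log a := by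
  have hcont : Continuous fun x : ℝ => Real.exp (-x) := by fun_prop
  have h := Frullani.integral_Ioi_eq (hcont.locallyIntegrable.locallyIntegrableOn _) ha one_pos
    (hcont.tendsto' 0 1 (by simp) |>.mono_left nhdsWithin_le_nhds)
    Real.tendsto_exp_neg_atTop_nhds_zero (integrableOn_frullaniExp ha)
  simpa [frullaniExp] using h

lemma integral_abs_frullaniExp {a : ℝ} (ha : 0 < a) :
    ∫ t in Ioi (0 : ℝ), |frullaniExp a t| = |Real.log a| := by
  rcases le_total a 1 with h | h
  · rw [abs_of_nonpos (Real.log_nonpos ha.le h), ← integral_frullaniExp ha]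
    exact setIntegral_congr_fun measurableSet_Ioi fun t ht =>
      abs_of_nonneg (frullaniExp_nonneg h ht)
  · rw [abs_of_nonneg (Real.log_nonneg h), ← neg_neg (Real.log a), ← integral_frullaniExp ha,
      ← integral_neg]
    exact setIntegral_congr_fun measurableSet_Ioi fun t ht =>
      abs_of_nonpos (frullaniExp_nonpos h ht)

lemma integral_mul_mul_frullaniExp_nonneg (hZ : Measurable Z) (hf : Integrable f μ)
    (hf0 : ∫ x, f x ∂μ = 0) {t : ℝ} (ht : 0 < t) :
    0 ≤ ∫ p : Ω × Ω, f p.1 * f p.2 * frullaniExp (‖Z p.1 - Z p.2‖ ^ 2) t ∂(μ.prod μ) := by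
  have hsplit (p : Ω × Ω) : f p.1 * f p.2 * frullaniExp (‖Z p.1 - Z p.2‖ ^ 2) t =
      t⁻¹ * (f p.1 * f p.2 * Real.exp (-t * ‖Z p.1 - Z p.2‖ ^ 2)) -
        t⁻¹ * Real.exp (-t) * (f p.1 * f p.2) := by
    simp only [frullaniExp, one_mul, neg_mul, mul_comm t]
    ring
  simp only [hsplit]
  rw [integral_sub ((integrable_mul_mul_exp_neg_mul_sq_norm_sub hZ hf ht.le).const_mul _)
      ((hf.mul_prod hf).const_mul _),
    integral_const_mul, integral_const_mul, integral_prod_mul f f, hf0, mul_zero, mul_zero,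
    sub_zero]
  exact mul_nonneg (inv_nonneg.2 ht.le)
    (integral_mul_mul_exp_neg_mul_sq_norm_sub_nonneg hZ hf ht)

/-- By Frullani's formula `-2 log r = ∫₀^∞ (e^{-r²t} - e^{-t}) / t dt` is a mixture of Gaussians up
to constants, and the constants do not contribute when `f` has mean zero. -/
lemma integral_mul_mul_log_norm_sub_nonpos (hZ : Measurable Z) (hf : Integrable f μ)
    (hf0 : ∫ x, f x ∂μ = 0) (hne : ∀ᵐ p ∂(μ.prod μ), Z p.1 ≠ Z p.2)
    (hint : Integrable (fun p : Ω × Ω => f p.1 * f p.2 * Real.log ‖Z p.1 - Z p.2‖) (μ.prod μ)) :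
    ∫ p : Ω × Ω, f p.1 * f p.2 * Real.log ‖Z p.1 - Z p.2‖ ∂(μ.prod μ) ≤ 0 := by
  let h : Ω × Ω → ℝ → ℝ := fun p t => f p.1 * f p.2 * frullaniExp (‖Z p.1 - Z p.2‖ ^ 2) t
  have hpos : ∀ᵐ p ∂(μ.prod μ), 0 < ‖Z p.1 - Z p.2‖ ^ 2 := by
    filter_upwards [hne] with p hp
    exact pow_pos (norm_pos_iff.2 (sub_ne_zero.2 hp)) 2
  have hmeas : Measurable fun q : (Ω × Ω) × ℝ => frullaniExp (‖Z q.1.1 - Z q.1.2‖ ^ 2) q.2 :=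
    measurable_frullaniExp.comp (f := fun q : (Ω × Ω) × ℝ => (‖Z q.1.1 - Z q.1.2‖ ^ 2, q.2))
      (by fun_prop)
  have hh : Integrable (Function.uncurry h) ((μ.prod μ).prod (volume.restrict (Ioi 0))) := by
    refine (integrable_prod_iff ?_).2 ⟨?_, ?_⟩
    · exact (hf.mul_prod hf).aestronglyMeasurable.comp_fst.mul hmeas.aestronglyMeasurable
    · filter_upwards [hpos] with p hp
      exact (integrableOn_frullaniExp hp).const_mul (f p.1 * f p.2)
    · refine (hint.norm.const_mul 2).congr ?_
      filter_upwards [hpos] with p hp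
      simp only [Function.uncurry, h, norm_mul, Real.norm_eq_abs, integral_const_mul,
        integral_abs_frullaniExp hp, Real.log_pow, abs_mul, Nat.cast_ofNat, abs_two]
      ring
  have hswap : -2 * ∫ p : Ω × Ω, f p.1 * f p.2 * Real.log ‖Z p.1 - Z p.2‖ ∂(μ.prod μ) =
      ∫ t in Ioi (0 : ℝ), ∫ p : Ω × Ω, h p t ∂(μ.prod μ) := by
    rw [← integral_integral_swap hh, ← integral_const_mul]
    refine integral_congr_ae ?_
    filter_upwards [hpos] with p hp
    simp only [h, integral_const_mul, integral_frullaniExp hp, Real.log_pow, Nat.cast_ofNat]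
    ring
  have hnonneg : 0 ≤ ∫ t in Ioi (0 : ℝ), ∫ p : Ω × Ω, h p t ∂(μ.prod μ) :=
    setIntegral_nonneg measurableSet_Ioi fun t ht =>
      integral_mul_mul_frullaniExp_nonneg hZ hf hf0 ht
  linarith

end ConditionallyPositiveDefinite

section CosineKernel

lemma integral_cos_nat_mul_zero_two_pi (j : ℕ) :
    ∫ x in (0 : ℝ)..2 * Real.pi, Real.cos (j * x) = if j = 0 then 2 * Real.pi else 0 := by
  split_ifs with hj
  · simp [hj]
  · rw [intervalIntegral.integral_comp_mul_left _ (Nat.cast_ne_zero.2 hj), integral_cos,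
      show (j : ℝ) * (2 * Real.pi) = (2 * j : ℕ) * Real.pi by push_cast; ring]
    simp only [mul_zero, Real.sin_nat_mul_pi, Real.sin_zero, sub_self, smul_zero]

lemma integral_cos_nat_mul_zero_pi {k : ℕ} (hk : k ≠ 0) :
    ∫ θ in (0 : ℝ)..Real.pi, Real.cos (k * θ) = 0 := by
  rw [intervalIntegral.integral_comp_mul_left _ (Nat.cast_ne_zero.2 hk), integral_cos]
  simp only [mul_zero, Real.sin_nat_mul_pi, Real.sin_zero, sub_self, smul_zero]

lemma integral_cos_nat_mul_mul_cos_nat_mul {k l : ℕ} (hk : k ≠ 0) :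
    ∫ θ in (0 : ℝ)..Real.pi, Real.cos (k * θ) * Real.cos (l * θ) =
      if k = l then Real.pi / 2 else 0 := by
  have h := Polynomial.Chebyshev.integral_eval_T_real_mul_eval_T_real_measureT k l
  rw [Polynomial.Chebyshev.integral_measureT_eq_integral_cos] at h
  simp only [Polynomial.Chebyshev.T_real_cos, Int.cast_natCast] at h
  rw [h, Polynomial.Chebyshev.integral_eval_T_real_measureT_of_ne_zero (by omega)]
  split_ifs with hkl
  · rw [hkl, sub_self, Polynomial.Chebyshev.integral_eval_T_real_measureT_zero, zero_add]
  · rw [Polynomial.Chebyshev.integral_eval_T_real_measureT_of_ne_zero (by omega), zero_add,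
      zero_div]

variable {g : ℝ → ℝ}

lemma integral_mul_sin_nat_mul_eq_zero (heven : g.Even) (hper : g.Periodic (2 * Real.pi)) (l : ℕ) :
    ∫ x in (0 : ℝ)..2 * Real.pi, g x * Real.sin (l * x) = 0 := by
  have hodd (x : ℝ) : g (2 * Real.pi - x) * Real.sin (l * (2 * Real.pi - x)) =
      -(g x * Real.sin (l * x)) := by
    rw [hper.sub_eq', heven, mul_sub, Real.sin_nat_mul_two_pi_sub, mul_neg]
  have h := intervalIntegral.integral_comp_sub_left (a := 0) (b := 2 * Real.pi)
    (fun x => g x * Real.sin (l * x)) (2 * Real.pi)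
  simp only [hodd, intervalIntegral.integral_neg, sub_self, sub_zero] at h
  linarith

lemma integral_comp_sub_mul_cos_nat_mul (heven : g.Even) (hper : g.Periodic (2 * Real.pi))
    (hg : IntervalIntegrable g volume 0 (2 * Real.pi)) (l : ℕ) (θ : ℝ) :
    ∫ φ in -Real.pi..Real.pi, g (θ - φ) * Real.cos (l * φ) =
      (∫ x in (0 : ℝ)..2 * Real.pi, g x * Real.cos (l * x)) * Real.cos (l * θ) := by
  have hshift : Function.Periodic (fun x => g x * Real.cos (l * (θ - x))) (2 * Real.pi) :=
    fun x => by
      simp only [hper x, ← sub_sub, mul_sub (l : ℝ) (θ - x), Real.cos_sub_nat_mul_two_pi]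
  have hexpand (x : ℝ) : g x * Real.cos (l * (θ - x)) =
      g x * Real.cos (l * x) * Real.cos (l * θ) + g x * Real.sin (l * x) * Real.sin (l * θ) := by
    rw [mul_sub, Real.cos_sub]
    ring
  have hcos : IntervalIntegrable (fun x => g x * Real.cos (l * x)) volume 0 (2 * Real.pi) :=
    hg.mul_continuousOn (by fun_prop)
  have hsin : IntervalIntegrable (fun x => g x * Real.sin (l * x)) volume 0 (2 * Real.pi) :=
    hg.mul_continuousOn (by fun_prop)
  calc ∫ φ in -Real.pi..Real.pi, g (θ - φ) * Real.cos (l * φ)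
      = ∫ x in θ - Real.pi..θ + Real.pi, g x * Real.cos (l * (θ - x)) := by
        simpa only [sub_sub_cancel, sub_neg_eq_add] using
          intervalIntegral.integral_comp_sub_left (a := -Real.pi) (b := Real.pi)
            (fun x => g x * Real.cos (l * (θ - x))) θ
    _ = ∫ x in (0 : ℝ)..2 * Real.pi, g x * Real.cos (l * (θ - x)) := by
        have h := hshift.intervalIntegral_add_eq (θ - Real.pi) 0
        rwa [zero_add, show θ - Real.pi + 2 * Real.pi = θ + Real.pi by ring] at h
    _ = _ := by
        simp only [hexpand]
        rw [intervalIntegral.integral_add (hcos.mul_const _) (hsin.mul_const _),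
          intervalIntegral.integral_mul_const, intervalIntegral.integral_mul_const,
          integral_mul_sin_nat_mul_eq_zero heven hper, zero_mul, add_zero]

lemma integral_comp_add_add_comp_sub_mul_cos_nat_mul (heven : g.Even)
    (hper : g.Periodic (2 * Real.pi)) (hg : IntervalIntegrable g volume 0 (2 * Real.pi))
    (l : ℕ) (θ : ℝ) :
    ∫ φ in (0 : ℝ)..Real.pi, (g (θ + φ) + g (θ - φ)) * Real.cos (l * φ) =
      (∫ x in (0 : ℝ)..2 * Real.pi, g x * Real.cos (l * x)) * Real.cos (l * θ) := by
  have hint (a b : ℝ) : IntervalIntegrable g volume a b :=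
    hper.intervalIntegrable₀ Real.two_pi_pos.ne' hg a b
  have hsub (a b : ℝ) :
      IntervalIntegrable (fun φ => g (θ - φ) * Real.cos (l * φ)) volume a b := by
    have h := (hint (θ - a) (θ - b)).comp_sub_left θ
    simp only [sub_sub_cancel] at h
    exact h.mul_continuousOn (by fun_prop)
  have hadd : IntervalIntegrable (fun φ => g (θ + φ) * Real.cos (l * φ)) volume 0 Real.pi := by
    have h := (hint (θ + 0) (θ + Real.pi)).comp_add_left θ
    simp only [add_sub_cancel_left] at h
    exact h.mul_continuousOn (by fun_prop)
  have hreflect : ∫ φ in (0 : ℝ)..Real.pi, g (θ + φ) * Real.cos (l * φ) =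
      ∫ φ in -Real.pi..0, g (θ - φ) * Real.cos (l * φ) := by
    simpa only [sub_neg_eq_add, mul_neg, Real.cos_neg, neg_zero] using
      intervalIntegral.integral_comp_neg (a := 0) (b := Real.pi)
        (fun φ => g (θ - φ) * Real.cos (l * φ))
  simp only [add_mul]
  rw [intervalIntegral.integral_add hadd (hsub _ _), hreflect,
    intervalIntegral.integral_add_adjacent_intervals (hsub _ _) (hsub _ _),
    integral_comp_sub_mul_cos_nat_mul heven hper hg]

/-- The uniform probability measure on the angles `(0, π]`. The map `s = cos θ` carries it to the
arcsine law, which is the equilibrium measure of `[-1, 1]`. -/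
noncomputable def angleMeasure : Measure ℝ :=
  ENNReal.ofReal Real.pi⁻¹ • volume.restrict (Ioc 0 Real.pi)

instance : IsProbabilityMeasure angleMeasure := ⟨by
  rw [angleMeasure, Measure.smul_apply, Measure.restrict_apply_univ, Real.volume_Ioc, sub_zero,
    smul_eq_mul, ← ENNReal.ofReal_mul (by positivity), inv_mul_cancel₀ Real.pi_ne_zero,
    ENNReal.ofReal_one]⟩

instance : NullSingletonClass angleMeasure := ⟨fun θ => by simp [angleMeasure]⟩

lemma integral_angleMeasure (f : ℝ → ℝ) :
    ∫ θ, f θ ∂angleMeasure = Real.pi⁻¹ * ∫ θ in (0 : ℝ)..Real.pi, f θ := by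
  rw [angleMeasure, integral_smul_measure, ENNReal.toReal_ofReal (by positivity), smul_eq_mul,
    intervalIntegral.integral_of_le Real.pi_pos.le]

lemma integrable_angleMeasure {f : ℝ → ℝ} (hf : IntervalIntegrable f volume 0 Real.pi) :
    Integrable f angleMeasure :=
  hf.1.smul_measure ENNReal.ofReal_ne_top

lemma ae_mem_Ioc_angleMeasure : ∀ᵐ θ ∂angleMeasure, θ ∈ Ioc 0 Real.pi :=
  Measure.ae_smul_measure (ae_restrict_mem measurableSet_Ioc) _

lemma integrable_abs_comp_add_add_abs_comp_sub (hmeas : Measurable g) (heven : g.Even)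
    (hper : g.Periodic (2 * Real.pi)) (hg : IntervalIntegrable g volume 0 (2 * Real.pi)) :
    Integrable (fun p : ℝ × ℝ => |g (p.1 + p.2)| + |g (p.1 - p.2)|)
      (angleMeasure.prod angleMeasure) := by
  have hint (a b : ℝ) : IntervalIntegrable g volume a b :=
    hper.intervalIntegrable₀ Real.two_pi_pos.ne' hg a b
  refine (integrable_prod_iff ?_).2 ⟨Eventually.of_forall fun θ => ?_, ?_⟩
  · exact (by fun_prop : Measurable _).aestronglyMeasurable
  · have hadd := (hint (θ + 0) (θ + Real.pi)).comp_add_left θ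
    have hsub := (hint (θ - 0) (θ - Real.pi)).comp_sub_left θ
    simp only [add_sub_cancel_left, sub_sub_cancel] at hadd hsub
    exact integrable_angleMeasure (hadd.abs.add hsub.abs)
  · have hmarginal (θ : ℝ) : ∫ φ, ‖|g (θ + φ)| + |g (θ - φ)|‖ ∂angleMeasure =
        Real.pi⁻¹ * ∫ x in (0 : ℝ)..2 * Real.pi, |g x| := by
      have h := integral_comp_add_add_comp_sub_mul_cos_nat_mul (g := fun x => |g x|)
        (fun x => congrArg abs (heven x)) (fun x => congrArg abs (hper x)) hg.abs 0 θ
      simp only [Nat.cast_zero, zero_mul, Real.cos_zero, mul_one] at h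
      rw [← h, ← integral_angleMeasure]
      exact integral_congr_ae (Eventually.of_forall fun φ => Real.norm_of_nonneg (by positivity))
    simp only [hmarginal]
    exact integrable_const _

end CosineKernel

section LogChord

/-- The logarithm `log |1 - e^{ix}|` of a chord of the unit circle; the absolute value is provided
by `Real.log`, which is even. -/
noncomputable def logChord (x : ℝ) : ℝ := Real.log (2 * Real.sin (x / 2))

lemma measurable_logChord : Measurable logChord := by
  unfold logChord
  fun_prop

lemma even_logChord : logChord.Even := fun x => by
  rw [logChord, neg_div, Real.sin_neg, mul_neg, Real.log_neg_eq_log, logChord]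

lemma periodic_logChord : logChord.Periodic (2 * Real.pi) := fun x => by
  rw [logChord, add_div, mul_div_cancel_left₀ _ two_ne_zero, Real.sin_add_pi, mul_neg,
    Real.log_neg_eq_log, logChord]

lemma intervalIntegrable_logChord (a b : ℝ) : IntervalIntegrable logChord volume a b :=
  MeromorphicOn.intervalIntegrable_log (f := fun x => 2 * Real.sin (x / 2)) fun _ _ =>
    AnalyticAt.meromorphicAt (by fun_prop)

lemma sin_nat_mul_eq_sin_half_mul_sum (l : ℕ) (x : ℝ) :
    Real.sin (l * x) =
      Real.sin (x / 2) * ∑ j ∈ Finset.range l, 2 * Real.cos ((2 * j + 1) * (x / 2)) := by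
  induction l with
  | zero => simp
  | succ l ih =>
    rw [Finset.sum_range_succ, mul_add, ← ih]
    have h := Real.sin_sub_sin (((l + 1 : ℕ) : ℝ) * x) (l * x)
    push_cast at h ⊢
    rw [show ((l + 1) * x - l * x) / 2 = x / 2 by ring,
      show ((l + 1) * x + l * x) / 2 = (2 * l + 1) * (x / 2) by ring] at h
    linarith

lemma cos_half_mul_sin_nat_mul (l : ℕ) (x : ℝ) :
    Real.cos (x / 2) * Real.sin (l * x) = Real.sin (x / 2) *
      ∑ j ∈ Finset.range l, (Real.cos ((j + 1 : ℕ) * x) + Real.cos (j * x)) := by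
  rw [sin_nat_mul_eq_sin_half_mul_sum, mul_left_comm, Finset.mul_sum]
  congr 1
  refine Finset.sum_congr rfl fun j _ => ?_
  rw [Real.cos_add_cos, show ((j + 1 : ℕ) * x + j * x) / 2 = (2 * j + 1) * (x / 2) by
    push_cast; ring, show ((j + 1 : ℕ) * x - j * x) / 2 = x / 2 by push_cast; ring]
  ring

lemma integral_sum_cos_add_cos {l : ℕ} (hl : l ≠ 0) :
    ∫ x in (0 : ℝ)..2 * Real.pi,
      ∑ j ∈ Finset.range l, (Real.cos ((j + 1 : ℕ) * x) + Real.cos (j * x)) = 2 * Real.pi := by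
  rw [intervalIntegral.integral_finsetSum
    fun j _ => (by fun_prop : Continuous _).intervalIntegrable _ _]
  have hterm (j : ℕ) : ∫ x in (0 : ℝ)..2 * Real.pi,
      (Real.cos ((j + 1 : ℕ) * x) + Real.cos (j * x)) = if j = 0 then 2 * Real.pi else 0 := by
    rw [intervalIntegral.integral_add ((by fun_prop : Continuous _).intervalIntegrable _ _)
      ((by fun_prop : Continuous _).intervalIntegrable _ _), integral_cos_nat_mul_zero_two_pi,
      integral_cos_nat_mul_zero_two_pi, if_neg j.succ_ne_zero, zero_add]
  simp only [hterm, Finset.sum_ite_eq', Finset.mem_range, Nat.pos_of_ne_zero hl, if_true]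

/-- At the zeros of the sine the singularity is of the form `x log x`. -/
lemma continuous_logChord_mul_sin_nat_mul (l : ℕ) :
    Continuous fun x => logChord x * Real.sin (l * x) := by
  have hfactor (x : ℝ) : logChord x * Real.sin (l * x) =
      2 * Real.sin (x / 2) * Real.log (2 * Real.sin (x / 2)) *
        ∑ j ∈ Finset.range l, Real.cos ((2 * j + 1) * (x / 2)) := by
    rw [sin_nat_mul_eq_sin_half_mul_sum, ← Finset.mul_sum, logChord]
    ring
  simp only [hfactor]
  exact (Real.continuous_mul_log.comp (by fun_prop : Continuous fun x => 2 * Real.sin (x / 2))).mul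
    (by fun_prop)

lemma hasDerivAt_logChord_mul_sin_nat_mul (l : ℕ) {x : ℝ} (hx : x ∈ Ioo 0 (2 * Real.pi)) :
    HasDerivAt (fun x => logChord x * Real.sin (l * x))
      (l * (logChord x * Real.cos (l * x)) + (1 / 2 : ℝ) *
        ∑ j ∈ Finset.range l, (Real.cos ((j + 1 : ℕ) * x) + Real.cos (j * x))) x := by
  have hsin : 0 < Real.sin (x / 2) :=
    Real.sin_pos_of_pos_of_lt_pi (by linarith [hx.1]) (by linarith [hx.2])
  have hchord : HasDerivAt (fun x : ℝ => 2 * Real.sin (x / 2))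
      (2 * (Real.cos (x / 2) * (1 / 2))) x := ((hasDerivAt_id x).div_const 2).sin.const_mul 2
  have hsin_mul : HasDerivAt (fun x : ℝ => Real.sin (l * x)) (Real.cos (l * x) * (l * 1)) x :=
    ((hasDerivAt_id x).const_mul (l : ℝ)).sin
  have hquot : 2 * (Real.cos (x / 2) * (1 / 2)) / (2 * Real.sin (x / 2)) * Real.sin (l * x) =
      (1 / 2 : ℝ) * ∑ j ∈ Finset.range l, (Real.cos ((j + 1 : ℕ) * x) + Real.cos (j * x)) := by
    rw [div_mul_eq_mul_div, div_eq_iff (by positivity)]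
    linear_combination cos_half_mul_sin_nat_mul l x
  convert! (hchord.log (by positivity)).mul hsin_mul using 1
  rw [hquot, logChord]
  ring

lemma integral_logChord_mul_cos_nat_mul {l : ℕ} (hl : l ≠ 0) :
    ∫ x in (0 : ℝ)..2 * Real.pi, logChord x * Real.cos (l * x) = -(Real.pi / l) := by
  have hlog : IntervalIntegrable (fun x => l * (logChord x * Real.cos (l * x)))
      volume 0 (2 * Real.pi) :=
    ((intervalIntegrable_logChord _ _).mul_continuousOn (by fun_prop)).const_mul _
  have hsum : IntervalIntegrable (fun x => (1 / 2 : ℝ) *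
      ∑ j ∈ Finset.range l, (Real.cos ((j + 1 : ℕ) * x) + Real.cos (j * x)))
      volume 0 (2 * Real.pi) := (by fun_prop : Continuous _).intervalIntegrable _ _
  have hend : Real.sin (l * (2 * Real.pi)) = 0 := by
    simpa using Real.sin_nat_mul_two_pi_sub 0 l
  have hFTC := intervalIntegral.integral_eq_sub_of_hasDerivAt_of_le Real.two_pi_pos.le
    (continuous_logChord_mul_sin_nat_mul l).continuousOn
    (fun x => hasDerivAt_logChord_mul_sin_nat_mul l) (hlog.add hsum)
  rw [intervalIntegral.integral_add hlog hsum, intervalIntegral.integral_const_mul,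
    intervalIntegral.integral_const_mul, integral_sum_cos_add_cos hl, hend,
    mul_zero, mul_zero, Real.sin_zero, mul_zero, sub_zero] at hFTC
  rw [eq_neg_iff_add_eq_zero]
  field_simp
  linarith

lemma log_cos_sub_cos {θ φ : ℝ} (h : Real.cos θ ≠ Real.cos φ) :
    Real.log (Real.cos θ - Real.cos φ) = logChord (θ + φ) + logChord (θ - φ) - Real.log 2 := by
  have hne := sub_ne_zero.2 h
  rw [Real.cos_sub_cos, mul_ne_zero_iff, mul_ne_zero_iff] at hne
  rw [Real.cos_sub_cos, neg_mul, neg_mul, Real.log_neg_eq_log, logChord, logChord,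
    Real.log_mul (mul_ne_zero two_ne_zero hne.1.2) hne.2, Real.log_mul two_ne_zero hne.1.2,
    Real.log_mul two_ne_zero hne.2]
  ring

/-- The functions `cos (l φ)` are the eigenfunctions of the logarithmic kernel of `[-1, 1]`. -/
lemma integral_log_cos_sub_cos_mul_cos_nat_mul {l : ℕ} (hl : l ≠ 0) {θ : ℝ}
    (hθ : θ ∈ Icc 0 Real.pi) :
    ∫ φ in (0 : ℝ)..Real.pi, Real.log (Real.cos θ - Real.cos φ) * Real.cos (l * φ) =
      -(Real.pi / l) * Real.cos (l * θ) := by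
  have hint : IntervalIntegrable
      (fun φ => (logChord (θ + φ) + logChord (θ - φ)) * Real.cos (l * φ)) volume 0 Real.pi := by
    have hadd := (intervalIntegrable_logChord (θ + 0) (θ + Real.pi)).comp_add_left θ
    have hsub := (intervalIntegrable_logChord (θ - 0) (θ - Real.pi)).comp_sub_left θ
    simp only [add_sub_cancel_left, sub_sub_cancel] at hadd hsub
    exact (hadd.add hsub).mul_continuousOn (by fun_prop)
  calc ∫ φ in (0 : ℝ)..Real.pi, Real.log (Real.cos θ - Real.cos φ) * Real.cos (l * φ)
      = ∫ φ in (0 : ℝ)..Real.pi, ((logChord (θ + φ) + logChord (θ - φ)) * Real.cos (l * φ) -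
          Real.log 2 * Real.cos (l * φ)) := by
        refine intervalIntegral.integral_congr_ae ?_
        filter_upwards [compl_mem_ae_iff.2 (measure_singleton θ)] with φ hφθ hφ
        rw [uIoc_of_le Real.pi_pos.le] at hφ
        rw [log_cos_sub_cos fun h => hφθ (Real.injOn_cos hθ (Ioc_subset_Icc_self hφ) h).symm,
          sub_mul]
    _ = _ := by
        rw [intervalIntegral.integral_sub hint
            ((by fun_prop : Continuous _).intervalIntegrable _ _),
          integral_comp_add_add_comp_sub_mul_cos_nat_mul even_logChord periodic_logChord
            (intervalIntegrable_logChord _ _), integral_logChord_mul_cos_nat_mul hl,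
          intervalIntegral.integral_const_mul, integral_cos_nat_mul_zero_pi hl, mul_zero, sub_zero]

lemma ae_fst_ne_snd {α : Type*} [MeasurableSpace α] [MeasurableEq α] (μ ν : Measure α)
    [SFinite ν] [NullSingletonClass ν] : ∀ᵐ p ∂(μ.prod ν), p.1 ≠ p.2 := by
  refine (Measure.ae_prod_iff_ae_ae measurableSet_diagonal.compl).2
    (Eventually.of_forall fun x => ?_)
  filter_upwards [compl_mem_ae_iff.2 (measure_singleton x)] with y hy
  exact fun h => hy h.symm

lemma ae_cos_ne_cos :
    ∀ᵐ p ∂(angleMeasure.prod angleMeasure), Real.cos p.1 ≠ Real.cos p.2 := by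
  filter_upwards [ae_fst_ne_snd _ _, Measure.quasiMeasurePreserving_fst.ae ae_mem_Ioc_angleMeasure,
    Measure.quasiMeasurePreserving_snd.ae ae_mem_Ioc_angleMeasure] with p hne h₁ h₂
  exact fun h => hne (Real.injOn_cos (Ioc_subset_Icc_self h₁) (Ioc_subset_Icc_self h₂) h)

lemma integrable_log_cos_sub_cos :
    Integrable (fun p : ℝ × ℝ => Real.log (Real.cos p.1 - Real.cos p.2))
      (angleMeasure.prod angleMeasure) := by
  refine ((integrable_abs_comp_add_add_abs_comp_sub measurable_logChord even_logChord
    periodic_logChord (intervalIntegrable_logChord _ _)).add (integrable_const |Real.log 2|)).mono'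
    (by fun_prop : Measurable _).aestronglyMeasurable ?_
  filter_upwards [ae_cos_ne_cos] with p hp
  rw [log_cos_sub_cos hp]
  exact (abs_sub _ _).trans (add_le_add_left (abs_add_le _ _) _)

end LogChord

section CosCoeff

/-- The cosine coefficient of a kernel on `(0, π]²`, as an average over `θ` and `φ`. In the
variables `s = cos θ`, `t = cos φ` it is, up to normalization, a Chebyshev coefficient. -/
noncomputable def cosCoeff (K : ℝ × ℝ → ℝ) (k l : ℕ) : ℝ :=
  ∫ p, K p * (Real.cos (k * p.1) * Real.cos (l * p.2)) ∂(angleMeasure.prod angleMeasure)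

variable {K L : ℝ × ℝ → ℝ}

lemma integrable_mul_cos_mul_cos (hK : Integrable K (angleMeasure.prod angleMeasure)) (k l : ℕ) :
    Integrable (fun p : ℝ × ℝ => K p * (Real.cos (k * p.1) * Real.cos (l * p.2)))
      (angleMeasure.prod angleMeasure) := by
  refine hK.mul_bdd (c := 1) (by fun_prop) (Eventually.of_forall fun p => ?_)
  rw [norm_mul]
  exact mul_le_one₀ (Real.abs_cos_le_one _) (norm_nonneg _) (Real.abs_cos_le_one _)

lemma cosCoeff_congr_ae (h : K =ᵐ[angleMeasure.prod angleMeasure] L) (k l : ℕ) :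
    cosCoeff K k l = cosCoeff L k l :=
  integral_congr_ae (h.mono fun p hp => by simp only [hp])

lemma cosCoeff_sub (hK : Integrable K (angleMeasure.prod angleMeasure))
    (hL : Integrable L (angleMeasure.prod angleMeasure)) (k l : ℕ) :
    cosCoeff (K - L) k l = cosCoeff K k l - cosCoeff L k l := by
  simp only [cosCoeff, Pi.sub_apply, sub_mul]
  exact integral_sub (integrable_mul_cos_mul_cos hK k l) (integrable_mul_cos_mul_cos hL k l)

lemma cosCoeff_eq_integral_integral (hK : Integrable K (angleMeasure.prod angleMeasure)) (k l : ℕ) :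
    cosCoeff K k l = (Real.pi ^ 2)⁻¹ * ∫ θ in (0 : ℝ)..Real.pi, ∫ φ in (0 : ℝ)..Real.pi,
      K (θ, φ) * Real.cos (k * θ) * Real.cos (l * φ) := by
  rw [cosCoeff, integral_prod _ (integrable_mul_cos_mul_cos hK k l)]
  simp only [integral_angleMeasure, intervalIntegral.integral_const_mul, ← mul_assoc, ← mul_inv, sq]

lemma cosCoeff_swap (K : ℝ × ℝ → ℝ) (k l : ℕ) : cosCoeff (K ∘ Prod.swap) k l = cosCoeff K l k := by
  rw [cosCoeff, cosCoeff, ← integral_prod_swap]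
  refine integral_congr_ae (Eventually.of_forall fun p => ?_)
  simp only [Function.comp_apply, Prod.swap_swap, Prod.fst_swap, Prod.snd_swap]
  ring

lemma cosCoeff_log_cos_sub_cos {k l : ℕ} (hk : k ≠ 0) (hl : l ≠ 0) :
    cosCoeff (fun p => Real.log (Real.cos p.1 - Real.cos p.2)) k l =
      if k = l then -(1 / (2 * k) : ℝ) else 0 := by
  have hinner (θ : ℝ) (hθ : θ ∈ uIcc 0 Real.pi) : ∫ φ in (0 : ℝ)..Real.pi,
      Real.log (Real.cos θ - Real.cos φ) * Real.cos (k * θ) * Real.cos (l * φ) =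
      -(Real.pi / l) * (Real.cos (k * θ) * Real.cos (l * θ)) := by
    rw [uIcc_of_le Real.pi_pos.le] at hθ
    simp only [mul_right_comm _ (Real.cos (k * θ)), intervalIntegral.integral_mul_const,
      integral_log_cos_sub_cos_mul_cos_nat_mul hl hθ]
    ring
  rw [cosCoeff_eq_integral_integral integrable_log_cos_sub_cos,
    intervalIntegral.integral_congr hinner, intervalIntegral.integral_const_mul,
    integral_cos_nat_mul_mul_cos_nat_mul hk]
  split_ifs with hkl
  · rw [hkl]
    field_simp
  · rw [mul_zero, mul_zero]

end CosCoeff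

section Selection

lemma exists_monotone_rightInvOn {f : ℝ → ℝ} {a b : ℝ} (hab : a ≤ b)
    (hf : ContinuousOn f (Icc a b)) (hfab : f a ≤ f b) :
    ∃ τ : ℝ → ℝ, Monotone τ ∧ MapsTo τ (Icc (f a) (f b)) (Icc a b) ∧
      RightInvOn τ f (Icc (f a) (f b)) := by
  let τ : ℝ → ℝ := fun u => sInf (Icc a b ∩ f ⁻¹' {u})
  have hbdd (u : ℝ) : BddBelow (Icc a b ∩ f ⁻¹' {u}) := bddBelow_Icc.mono inter_subset_left
  have hτ : ∀ u ∈ Icc (f a) (f b), τ u ∈ Icc a b ∩ f ⁻¹' {u} := fun u hu =>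
    (hf.preimage_isClosed_of_isClosed isClosed_Icc isClosed_singleton).csInf_mem
      (intermediate_value_Icc hab hf hu) (hbdd u)
  have hmono : MonotoneOn τ (Icc (f a) (f b)) := fun u hu v hv huv => by
    obtain ⟨⟨hav, hvb⟩, hfv⟩ := hτ v hv
    obtain ⟨x, hx, hxu⟩ := intermediate_value_Icc hav (hf.mono (Icc_subset_Icc_right hvb))
      ⟨hu.1, huv.trans_eq hfv.symm⟩
    exact (csInf_le (hbdd u) ⟨⟨hx.1, hx.2.trans hvb⟩, hxu⟩).trans hx.2
  obtain ⟨g, hg, heq⟩ := hmono.exists_monotone_extension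
    (hmono.map_bddBelow subset_rfl ⟨f a, fun u hu => hu.1, left_mem_Icc.2 hfab⟩)
    (hmono.map_bddAbove subset_rfl ⟨f b, fun u hu => hu.2, right_mem_Icc.2 hfab⟩)
  exact ⟨g, hg, fun u hu => heq hu ▸ (hτ u hu).1, fun u hu => heq hu ▸ (hτ u hu).2⟩

lemma exists_measurable_mem_image_dist_eq {X : Type*} [PseudoMetricSpace X] [MeasurableSpace X]
    [BorelSpace X] {z : ℝ → X} {a b : ℝ} (hab : a ≤ b) (hz : ContinuousOn z (Icc a b)) :
    ∃ ζ : ℝ → X, Measurable ζ ∧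
      ∀ r ∈ Icc 0 (dist (z b) (z a)), ζ r ∈ z '' Icc a b ∧ dist (ζ r) (z a) = r := by
  obtain ⟨τ, hτ, hmaps, hinv⟩ := exists_monotone_rightInvOn (f := fun x => dist (z x) (z a)) hab
    (by fun_prop) ((dist_self (z a)).trans_le dist_nonneg)
  simp only [dist_self] at hmaps hinv
  have hextend : Continuous (IccExtend hab ((Icc a b).domRestrict z)) :=
    (continuousOn_iff_continuous_domRestrict.1 hz).Icc_extend'
  refine ⟨IccExtend hab ((Icc a b).domRestrict z) ∘ τ, hextend.measurable.comp hτ.measurable,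
    fun r hr => ?_⟩
  rw [Function.comp_apply, IccExtend_of_mem hab _ (hmaps hr), domRestrict_apply]
  exact ⟨mem_image_of_mem z (hmaps hr), hinv hr⟩

end Selection

section LogEnergy

lemma measurable_logKernel : Measurable fun p : ℂ × ℂ => logKernel p.1 p.2 := by
  unfold logKernel
  exact (ENNReal.measurable_log.comp measurable_edist).neg

lemma toENNReal_logKernel {z w : ℂ} (h : z ≠ w) :
    (logKernel z w).toENNReal = ENNReal.ofReal (-Real.log ‖z - w‖) := by
  rw [logKernel, edist_dist, dist_eq_norm,
    ENNReal.log_ofReal_of_pos (norm_pos_iff.2 (sub_ne_zero.2 h)), ← EReal.coe_neg,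
    EReal.real_coe_toENNReal]

lemma lintegral_lintegral_logKernel_map {Ω : Type*} [MeasurableSpace Ω] {m : Measure Ω} [SFinite m]
    {Z : Ω → ℂ} (hZ : Measurable Z) (hne : ∀ᵐ p ∂(m.prod m), Z p.1 ≠ Z p.2) :
    ∫⁻ z, ∫⁻ w, (logKernel z w).toENNReal ∂(m.map Z) ∂(m.map Z) =
      ∫⁻ p, ENNReal.ofReal (-Real.log ‖Z p.1 - Z p.2‖) ∂(m.prod m) := by
  have hK : Measurable fun p : ℂ × ℂ => (logKernel p.1 p.2).toENNReal :=
    measurable_logKernel.ereal_toENNReal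
  rw [← lintegral_prod _ hK.aemeasurable, Measure.map_prod_map _ _ hZ hZ,
    lintegral_map hK (hZ.prodMap hZ)]
  exact lintegral_congr_ae (hne.mono fun p hp => toENNReal_logKernel hp)

lemma logEnergy_lt_top {μ : Measure ℂ}
    (h : ∫⁻ z, ∫⁻ w, (logKernel z w).toENNReal ∂μ ∂μ ≠ ⊤) : logEnergy μ < ⊤ := by
  rw [logEnergy, sub_eq_add_neg]
  refine EReal.add_lt_top (by simpa using h) (ne_top_of_le_ne_top EReal.zero_ne_top ?_)
  rw [EReal.neg_le, neg_zero]
  exact EReal.coe_ennreal_nonneg _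

lemma lintegral_neg_logKernel_ne_top {K : Set ℂ} (hK : Bornology.IsBounded K) {μ : Measure ℂ}
    (hμ : IsProbabilityOn K μ) : ∫⁻ z, ∫⁻ w, (-logKernel z w).toENNReal ∂μ ∂μ ≠ ⊤ := by
  obtain ⟨hprob, hμK⟩ := hμ
  obtain ⟨C, hC⟩ := Metric.isBounded_iff.1 hK
  have hmem : ∀ᵐ z ∂μ, z ∈ K := hμK
  refine ne_top_of_le_ne_top (b := (ENNReal.log (ENNReal.ofReal C)).toENNReal) ?_ ?_
  · rw [EReal.toENNReal_ne_top_iff, Ne, ENNReal.log_eq_top_iff]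
    exact ENNReal.ofReal_ne_top
  calc ∫⁻ z, ∫⁻ w, (-logKernel z w).toENNReal ∂μ ∂μ
      ≤ ∫⁻ _, ∫⁻ _, (ENNReal.log (ENNReal.ofReal C)).toENNReal ∂μ ∂μ := by
        refine lintegral_mono_ae (hmem.mono fun z hz =>
          lintegral_mono_ae (hmem.mono fun w hw => ?_))
        rw [logKernel, neg_neg, edist_dist]
        exact EReal.toENNReal_le_toENNReal
          (ENNReal.log_le_log (ENNReal.ofReal_le_ofReal (hC hz hw)))
    _ = _ := by simp only [lintegral_const, measure_univ, mul_one]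

lemma lintegral_logKernel_ne_top {K : Set ℂ} (hK : Bornology.IsBounded K) {μ : Measure ℂ}
    (hμ : IsProbabilityOn K μ) (hfin : logEnergy μ < ⊤) :
    ∫⁻ z, ∫⁻ w, (logKernel z w).toENNReal ∂μ ∂μ ≠ ⊤ := by
  intro htop
  rw [logEnergy, htop, ← ENNReal.ofReal_toReal (lintegral_neg_logKernel_ne_top hK hμ),
    EReal.coe_ennreal_ofReal, EReal.coe_ennreal_top, EReal.top_sub_coe] at hfin
  exact lt_irrefl _ hfin

lemma lintegral_logKernel_map_angleMeasure_ne_top {Z : ℝ → ℂ} (hZ : Measurable Z) {c : ℝ}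
    (hc : 0 < c) (hlower : ∀ θ φ, c * |Real.cos θ - Real.cos φ| ≤ ‖Z θ - Z φ‖) :
    ∫⁻ z, ∫⁻ w, (logKernel z w).toENNReal ∂(angleMeasure.map Z) ∂(angleMeasure.map Z) ≠ ⊤ := by
  have hpos : ∀ᵐ p ∂(angleMeasure.prod angleMeasure), 0 < c * |Real.cos p.1 - Real.cos p.2| :=
    ae_cos_ne_cos.mono fun p hp => mul_pos hc (abs_pos.2 (sub_ne_zero.2 hp))
  rw [lintegral_lintegral_logKernel_map hZ
    (hpos.mono fun p hp => sub_ne_zero.1 (norm_pos_iff.1 (hp.trans_le (hlower p.1 p.2))))]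
  refine (lt_of_le_of_lt (lintegral_mono_ae ?_)
    ((integrable_const (-Real.log c)).sub integrable_log_cos_sub_cos).2).ne
  filter_upwards [hpos] with p hp
  rw [← ofReal_norm]
  refine ENNReal.ofReal_le_ofReal (le_trans ?_ (le_abs_self _))
  rw [Pi.sub_apply, ← Real.log_abs (_ - _), ← neg_add', neg_le_neg_iff,
    ← Real.log_mul hc.ne' (pos_of_mul_pos_right hp hc.le).ne']
  exact Real.log_le_log hp (hlower p.1 p.2)

/-- The mass is spread along the curve so that its distance to the first endpoint follows the
arcsine law; the reverse triangle inequality then compares its energy with that of a segment. -/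
lemma exists_isProbabilityOn_logEnergy_lt_top {z : ℝ → ℂ} {a b : ℝ} (hab : a ≤ b)
    (hz : ContinuousOn z (Icc a b)) (hne : z a ≠ z b) :
    ∃ μ, IsProbabilityOn (z '' Icc a b) μ ∧ logEnergy μ < ⊤ := by
  obtain ⟨ζ, hζ, hζspec⟩ := exists_measurable_mem_image_dist_eq hab hz
  set c := dist (z b) (z a) / 2 with hc
  have hcpos : 0 < c := half_pos (dist_pos.2 hne.symm)
  have hr (θ : ℝ) : c * (1 + Real.cos θ) ∈ Icc 0 (dist (z b) (z a)) :=
    ⟨mul_nonneg hcpos.le (by linarith [Real.neg_one_le_cos θ]), by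
      nlinarith [Real.cos_le_one θ]⟩
  let Z : ℝ → ℂ := fun θ => ζ (c * (1 + Real.cos θ))
  have hZ : Measurable Z := hζ.comp (by fun_prop)
  have hlower (θ φ : ℝ) : c * |Real.cos θ - Real.cos φ| ≤ ‖Z θ - Z φ‖ :=
    calc c * |Real.cos θ - Real.cos φ|
        = |c * (1 + Real.cos θ) - c * (1 + Real.cos φ)| := by
          rw [← mul_sub, add_sub_add_left_eq_sub, abs_mul, abs_of_pos hcpos]
      _ = |dist (Z θ) (z a) - dist (Z φ) (z a)| := by
          rw [(hζspec _ (hr θ)).2, (hζspec _ (hr φ)).2]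
      _ ≤ ‖Z θ - Z φ‖ := (abs_dist_sub_le _ _ _).trans_eq (dist_eq_norm _ _)
  refine ⟨angleMeasure.map Z, ⟨Measure.isProbabilityMeasure_map hZ.aemeasurable, ?_⟩,
    logEnergy_lt_top (lintegral_logKernel_map_angleMeasure_ne_top hZ hcpos hlower)⟩
  exact (ae_map_iff hZ.aemeasurable (isCompact_Icc.image_of_continuousOn hz).measurableSet).2
    (Eventually.of_forall fun θ => (hζspec _ (hr θ)).1)

lemma integrable_log_norm_sub {Ω : Type*} [MeasurableSpace Ω] {m : Measure Ω}
    [IsFiniteMeasure m] {Z : Ω → ℂ} (hZ : Measurable Z) (hbdd : Bornology.IsBounded (range Z))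
    (hne : ∀ᵐ p ∂(m.prod m), Z p.1 ≠ Z p.2)
    (hfin : ∫⁻ z, ∫⁻ w, (logKernel z w).toENNReal ∂(m.map Z) ∂(m.map Z) ≠ ⊤) :
    Integrable (fun p : Ω × Ω => Real.log ‖Z p.1 - Z p.2‖) (m.prod m) := by
  obtain ⟨C, hC⟩ := Metric.isBounded_range_iff.1 hbdd
  rw [lintegral_lintegral_logKernel_map hZ hne] at hfin
  refine ⟨(by fun_prop : Measurable _).aestronglyMeasurable, ?_⟩
  calc ∫⁻ p, ‖Real.log ‖Z p.1 - Z p.2‖‖ₑ ∂(m.prod m)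
      ≤ ∫⁻ p, (ENNReal.ofReal (-Real.log ‖Z p.1 - Z p.2‖) + ENNReal.ofReal C) ∂(m.prod m) := by
        refine lintegral_mono fun p => ?_
        have hlog := Real.log_le_self (norm_nonneg (Z p.1 - Z p.2))
        have hle := hC p.1 p.2
        rw [dist_eq_norm] at hle
        rw [← ofReal_norm, Real.norm_eq_abs]
        rcases abs_cases (Real.log ‖Z p.1 - Z p.2‖) with ⟨habs, -⟩ | ⟨habs, -⟩
        · exact le_add_left (ENNReal.ofReal_le_ofReal (by linarith))
        · exact le_add_right (ENNReal.ofReal_le_ofReal habs.le)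
    _ < ⊤ := by
        rw [lintegral_add_right _ measurable_const, lintegral_const]
        exact ENNReal.add_lt_top.2 ⟨hfin.lt_top, ENNReal.mul_lt_top ENNReal.ofReal_lt_top
          (measure_lt_top _ _)⟩

end LogEnergy

section EquilibriumParametrization

lemma integral_one_div_sqrt_one_sub_sq {t : ℝ} (ht : t ∈ Icc (-1 : ℝ) 1) :
    ∫ s in (-1 : ℝ)..t, 1 / Real.sqrt (1 - s ^ 2) = Real.pi - Real.arccos t := by
  have hint : IntervalIntegrable (fun s : ℝ => 1 / Real.sqrt (1 - s ^ 2)) volume (-1) t := by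
    simp only [one_div, ← Real.sqrt_inv]
    refine Polynomial.Chebyshev.intervalIntegrable_sqrt_one_sub_sq_inv.mono_set ?_
    rw [uIcc_of_le ht.1, uIcc_of_le (by norm_num)]
    exact Icc_subset_Icc_right ht.2
  have hderiv : ∀ s ∈ Ioo (-1) t,
      HasDerivAt (fun s => -Real.arccos s) (1 / Real.sqrt (1 - s ^ 2)) s := fun s hs => by
    simpa only [neg_neg] using!
      (Real.hasDerivAt_arccos hs.1.ne' (hs.2.trans_le ht.2).ne).neg
  rw [intervalIntegral.integral_eq_sub_of_hasDerivAt_of_le ht.1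
    (by fun_prop) hderiv hint, Real.arccos_neg_one]
  ring

lemma angleMeasure_cos_le {t : ℝ} (ht : t ∈ Icc (-1 : ℝ) 1) :
    angleMeasure {θ | Real.cos θ ≤ t} = ENNReal.ofReal (Real.pi⁻¹ * (Real.pi - Real.arccos t)) := by
  have hae : {θ | Real.cos θ ≤ t} =ᵐ[angleMeasure] Ioi (Real.arccos t) := by
    filter_upwards [ae_mem_Ioc_angleMeasure, compl_mem_ae_iff.2 (measure_singleton (Real.arccos t))]
      with θ hθ hne
    have hle := Real.strictAntiOn_cos.le_iff_ge (Ioc_subset_Icc_self hθ)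
      ⟨Real.arccos_nonneg t, Real.arccos_le_pi t⟩
    rw [Real.cos_arccos ht.1 ht.2] at hle
    exact propext (hle.trans (Ne.le_iff_lt (Ne.symm hne)))
  rw [measure_congr hae, angleMeasure, Measure.smul_apply, Measure.restrict_apply measurableSet_Ioi,
    inter_comm, Ioc_inter_Ioi, sup_of_le_right (Real.arccos_nonneg t), Real.volume_Ioc, smul_eq_mul,
    ← ENNReal.ofReal_mul (by positivity)]

lemma measure_ext_of_image_Icc {X : Type*} [TopologicalSpace X] [T2Space X] [MeasurableSpace X]
    [BorelSpace X] {z : ℝ → X} {a b : ℝ} (hz : ContinuousOn z (Icc a b)) (hinj : InjOn z (Icc a b))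
    {μ ν : Measure X} [IsFiniteMeasure μ] (hμ : μ (z '' Icc a b)ᶜ = 0)
    (hν : ν (z '' Icc a b)ᶜ = 0) (h : ∀ t ∈ Icc a b, μ (z '' Icc a t) = ν (z '' Icc a t)) :
    μ = ν := by
  let e : Icc a b → X := (Icc a b).domRestrict z
  have he : MeasurableEmbedding e :=
    ((continuousOn_iff_continuous_domRestrict.1 hz).isClosedEmbedding
      (injOn_iff_injective.1 hinj)).measurableEmbedding
  have hmap {ρ : Measure X} (hρ : ρ (z '' Icc a b)ᶜ = 0) : (ρ.comap e).map e = ρ := by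
    rw [he.map_comap, show range e = z '' Icc a b from range_domRestrict z _]
    exact Measure.restrict_eq_self_of_ae_mem hρ
  have himage (t : Icc a b) : e '' Iic t = z '' Icc a t := by
    ext x
    constructor
    · rintro ⟨s, hs, rfl⟩
      exact ⟨s, ⟨s.2.1, hs⟩, rfl⟩
    · rintro ⟨s, hs, rfl⟩
      exact ⟨⟨s, hs.1, hs.2.trans t.2.2⟩, hs.2, rfl⟩
  rw [← hmap hμ, ← hmap hν, Measure.ext_of_Iic (μ.comap e) (ν.comap e) fun t => by
    rw [he.comap_apply, he.comap_apply, himage, h t t.2]]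

lemma continuous_comp_cos {X : Type*} [TopologicalSpace X] {z : ℝ → X}
    (hz : ContinuousOn z (Icc (-1) 1)) : Continuous fun θ => z (Real.cos θ) :=
  hz.comp_continuous Real.continuous_cos Real.cos_mem_Icc

variable {p q : ℂ} {γ : Set ℂ} {z : ℝ → ℂ} {ν : Measure ℂ}

lemma map_comp_cos_eq (hcont : ContinuousOn z (Icc (-1) 1)) (hinj : InjOn z (Icc (-1) 1))
    (hν : ν (z '' Icc (-1) 1)ᶜ = 0)
    (hνt : ∀ t ∈ Icc (-1 : ℝ) 1, ν (z '' Icc (-1) t) =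
      ENNReal.ofReal (1 / Real.pi * ∫ s in (-1 : ℝ)..t, 1 / Real.sqrt (1 - s ^ 2))) :
    angleMeasure.map (fun θ => z (Real.cos θ)) = ν := by
  have hZ := (continuous_comp_cos hcont).measurable
  have hclosed {t : ℝ} (ht : t ≤ 1) : MeasurableSet (z '' Icc (-1) t) :=
    (isCompact_Icc.image_of_continuousOn (hcont.mono (Icc_subset_Icc_right ht))).measurableSet
  have : IsProbabilityMeasure (angleMeasure.map fun θ => z (Real.cos θ)) :=
    Measure.isProbabilityMeasure_map hZ.aemeasurable
  refine measure_ext_of_image_Icc hcont hinj ?_ hν fun t ht => ?_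
  · exact (ae_map_iff hZ.aemeasurable (hclosed le_rfl)).2
      (Eventually.of_forall fun θ => mem_image_of_mem z (Real.cos_mem_Icc θ))
  have hpre : (fun θ => z (Real.cos θ)) ⁻¹' (z '' Icc (-1) t) = {θ | Real.cos θ ≤ t} := by
    ext θ
    exact (hinj.mem_image_iff (Icc_subset_Icc_right ht.2) (Real.cos_mem_Icc θ)).trans
      (and_iff_right (Real.neg_one_le_cos θ))
  rw [Measure.map_apply hZ (hclosed ht.2), hpre, angleMeasure_cos_le ht, hνt t ht,
    integral_one_div_sqrt_one_sub_sq ht, one_div]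

lemma ae_comp_cos_ne {X : Type*} {z : ℝ → X} (hinj : InjOn z (Icc (-1) 1)) :
    ∀ᵐ p ∂(angleMeasure.prod angleMeasure), z (Real.cos p.1) ≠ z (Real.cos p.2) :=
  ae_cos_ne_cos.mono fun _ hp h => hp (hinj (Real.cos_mem_Icc _) (Real.cos_mem_Icc _) h)

/-- The logarithmic kernel of the curve `z` in the angles of its two points; its cosine coefficients
are the entries of `I + B` up to a factor. -/
noncomputable def arcLogKernel (z : ℝ → ℂ) (p : ℝ × ℝ) : ℝ :=
  Real.log ‖z (Real.cos p.1) - z (Real.cos p.2)‖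

lemma integrable_arcLogKernel (hz : IsEquilibriumParametrization p q γ z) :
    Integrable (arcLogKernel z) (angleMeasure.prod angleMeasure) := by
  obtain ⟨hcont, hinj, rfl, -, -, ν, ⟨hνprob, hmin⟩, hνt⟩ := hz
  have hne : z (-1) ≠ z 1 := fun h => absurd
    (hinj (left_mem_Icc.2 (by norm_num)) (right_mem_Icc.2 (by norm_num)) h) (by norm_num)
  have hbdd := (isCompact_Icc.image_of_continuousOn hcont).isBounded
  obtain ⟨μ, hμ, hμfin⟩ := exists_isProbabilityOn_logEnergy_lt_top (by norm_num) hcont hne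
  refine integrable_log_norm_sub (continuous_comp_cos hcont).measurable
    (hbdd.subset (range_subset_iff.2 fun θ => mem_image_of_mem z (Real.cos_mem_Icc θ)))
    (ae_comp_cos_ne hinj) ?_
  rw [map_comp_cos_eq hcont hinj hνprob.2 hνt]
  exact lintegral_logKernel_ne_top hbdd hνprob ((hmin μ hμ).trans_lt hμfin)

end EquilibriumParametrization

section CosineSeries

variable {K : ℝ × ℝ → ℝ}

section CosinePolynomial

variable {ι : Type*} (F : Finset ι) (n : ι → ℕ) (c : ι → ℝ)

lemma sum_cos_mul_sum_cos_mul (θ φ r : ℝ) :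
    (∑ i ∈ F, c i * Real.cos (n i * θ)) * (∑ j ∈ F, c j * Real.cos (n j * φ)) * r =
      ∑ i ∈ F, ∑ j ∈ F, c i * c j * (r * (Real.cos (n i * θ) * Real.cos (n j * φ))) := by
  rw [Finset.sum_mul_sum, Finset.sum_mul]
  refine Finset.sum_congr rfl fun i _ => ?_
  rw [Finset.sum_mul]
  exact Finset.sum_congr rfl fun j _ => by ring

lemma integrable_sum_cos_mul_sum_cos_mul (hK : Integrable K (angleMeasure.prod angleMeasure)) :
    Integrable (fun p : ℝ × ℝ => (∑ i ∈ F, c i * Real.cos (n i * p.1)) *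
      (∑ j ∈ F, c j * Real.cos (n j * p.2)) * K p) (angleMeasure.prod angleMeasure) := by
  simp only [sum_cos_mul_sum_cos_mul]
  exact integrable_finsetSum _ fun i _ => integrable_finsetSum _ fun j _ =>
    (integrable_mul_cos_mul_cos hK _ _).const_mul _

lemma integral_sum_cos_mul_sum_cos_mul (hK : Integrable K (angleMeasure.prod angleMeasure)) :
    ∫ p, (∑ i ∈ F, c i * Real.cos (n i * p.1)) * (∑ j ∈ F, c j * Real.cos (n j * p.2)) * K p
      ∂(angleMeasure.prod angleMeasure) =
      ∑ i ∈ F, ∑ j ∈ F, c i * c j * cosCoeff K (n i) (n j) := by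
  have hint (i j : ι) : Integrable (fun p => c i * c j *
      (K p * (Real.cos (n i * p.1) * Real.cos (n j * p.2)))) (angleMeasure.prod angleMeasure) :=
    (integrable_mul_cos_mul_cos hK (n i) (n j)).const_mul _
  simp only [sum_cos_mul_sum_cos_mul]
  rw [integral_finsetSum _ fun i _ => integrable_finsetSum _ fun j _ => hint i j]
  refine Finset.sum_congr rfl fun i _ => ?_
  rw [integral_finsetSum _ fun j _ => hint i j]
  exact Finset.sum_congr rfl fun j _ => integral_const_mul _ _

end CosinePolynomial

lemma cosCoeff_const (c : ℝ) {k : ℕ} (hk : k ≠ 0) (l : ℕ) : cosCoeff (fun _ => c) k l = 0 := by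
  rw [cosCoeff, integral_const_mul, integral_prod_mul (fun θ => Real.cos (k * θ))
    fun φ => Real.cos (l * φ), integral_angleMeasure, integral_cos_nat_mul_zero_pi hk, mul_zero,
    zero_mul, mul_zero]

lemma cosCoeff_cos_mul_cos {i j : ℕ} (hi : i ≠ 0) (hj : j ≠ 0) (k l : ℕ) :
    cosCoeff (fun p => Real.cos (i * p.1) * Real.cos (j * p.2)) k l =
      if (i, j) = (k, l) then 1 / 4 else 0 := by
  rw [cosCoeff, integral_congr_ae (Eventually.of_forall fun p => mul_mul_mul_comm _ _ _ _),
    integral_prod_mul (fun θ => Real.cos (i * θ) * Real.cos (k * θ))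
      fun φ => Real.cos (j * φ) * Real.cos (l * φ), integral_angleMeasure, integral_angleMeasure,
    integral_cos_nat_mul_mul_cos_nat_mul hi, integral_cos_nat_mul_mul_cos_nat_mul hj]
  simp only [Prod.mk.injEq, ite_and]
  split_ifs
  · field_simp
    norm_num
  all_goals simp only [mul_zero, zero_mul]

lemma integrable_cos_mul_cos (k l : ℕ) :
    Integrable (fun p : ℝ × ℝ => Real.cos (k * p.1) * Real.cos (l * p.2))
      (angleMeasure.prod angleMeasure) := by
  simpa only [one_mul] using integrable_mul_cos_mul_cos (integrable_const 1) k l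

lemma cosCoeff_sum_cos_mul_cos (a : ℕ+ × ℕ+ → ℝ) {F : Finset (ℕ+ × ℕ+)} {kl : ℕ+ × ℕ+}
    (h : kl ∈ F) :
    cosCoeff (fun p => ∑ ij ∈ F, a ij * (Real.cos ((ij.1 : ℕ) * p.1) * Real.cos ((ij.2 : ℕ) * p.2)))
      kl.1 kl.2 = a kl / 4 := by
  calc _ = ∑ ij ∈ F, a ij * cosCoeff (fun p =>
          Real.cos ((ij.1 : ℕ) * p.1) * Real.cos ((ij.2 : ℕ) * p.2)) kl.1 kl.2 := by
        simp only [cosCoeff, Finset.sum_mul, mul_assoc (a _), ← integral_const_mul]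
        exact integral_finsetSum _ fun ij _ =>
          (integrable_mul_cos_mul_cos (integrable_cos_mul_cos _ _) _ _).const_mul _
    _ = ∑ ij ∈ F, if ij = kl then a ij / 4 else 0 := by
        refine Finset.sum_congr rfl fun ij _ => ?_
        simp only [cosCoeff_cos_mul_cos ij.1.ne_zero ij.2.ne_zero, Prod.ext_iff, PNat.coe_inj]
        split_ifs <;> ring
    _ = a kl / 4 := by rw [Finset.sum_ite_eq' F kl, if_pos h]

lemma abs_cosCoeff_le {C : ℝ} (hC : ∀ᵐ p ∂(angleMeasure.prod angleMeasure), |K p| ≤ C) (k l : ℕ) :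
    |cosCoeff K k l| ≤ C := by
  have hbound : ∀ᵐ p ∂(angleMeasure.prod angleMeasure),
      ‖K p * (Real.cos (k * p.1) * Real.cos (l * p.2))‖ ≤ C := hC.mono fun p hp => by
    rw [norm_mul, norm_mul]
    exact (mul_le_of_le_one_right (norm_nonneg _) (mul_le_one₀ (Real.abs_cos_le_one _)
      (norm_nonneg _) (Real.abs_cos_le_one _))).trans hp
  rw [← Real.norm_eq_abs, cosCoeff]
  simpa only [probReal_univ, mul_one] using norm_integral_le_of_norm_le_const hbound

lemma cosCoeff_eq_of_uniform_limit (hK : Integrable K (angleMeasure.prod angleMeasure))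
    {a : ℕ+ × ℕ+ → ℝ} (h : ∀ ε > 0, ∀ᶠ F : Finset (ℕ+ × ℕ+) in atTop,
      ∀ᵐ p ∂(angleMeasure.prod angleMeasure), |K p -
        ∑ ij ∈ F, a ij * (Real.cos ((ij.1 : ℕ) * p.1) * Real.cos ((ij.2 : ℕ) * p.2))| ≤ ε)
    (kl : ℕ+ × ℕ+) : cosCoeff K kl.1 kl.2 = a kl / 4 := by
  refine eq_of_abs_sub_le_all fun ε hε => ?_
  obtain ⟨F, hF, hkl⟩ := ((h ε hε).and (eventually_ge_atTop {kl})).exists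
  rw [← cosCoeff_sum_cos_mul_cos a (Finset.singleton_subset_iff.1 hkl), ← cosCoeff_sub hK
    (integrable_finsetSum _ fun ij _ => (integrable_cos_mul_cos _ _).const_mul _)]
  exact abs_cosCoeff_le hF _ _

end CosineSeries

section ArcGrunskyCoefficients

/-- The logarithm of the difference quotient of `z`, in the angles of its two points; its cosine
coefficients are the arc-Grunsky coefficients up to a factor. -/
noncomputable def logQuotientKernel (z : ℝ → ℂ) (p : ℝ × ℝ) : ℝ :=
  Real.log ‖(z (Real.cos p.1) - z (Real.cos p.2)) / ((Real.cos p.1 : ℂ) - (Real.cos p.2 : ℂ))‖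

lemma logQuotientKernel_swap (z : ℝ → ℂ) :
    logQuotientKernel z ∘ Prod.swap = logQuotientKernel z := by
  ext p
  rw [Function.comp_apply, logQuotientKernel, logQuotientKernel, Prod.fst_swap, Prod.snd_swap,
    ← neg_sub (z _), ← neg_sub (Real.cos p.1 : ℂ), neg_div_neg_eq]

lemma logQuotientKernel_ae_eq {z : ℝ → ℂ} (hinj : InjOn z (Icc (-1) 1)) :
    logQuotientKernel z =ᵐ[angleMeasure.prod angleMeasure]
      arcLogKernel z - fun p => Real.log (Real.cos p.1 - Real.cos p.2) := by
  filter_upwards [ae_comp_cos_ne hinj, ae_cos_ne_cos] with p hz hcos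
  rw [logQuotientKernel, ← Complex.ofReal_sub, norm_div, Complex.norm_real,
    Real.log_div (norm_ne_zero_iff.2 (sub_ne_zero.2 hz)) (norm_ne_zero_iff.2 (sub_ne_zero.2 hcos)),
    Real.norm_eq_abs, Real.log_abs, Pi.sub_apply, arcLogKernel]

variable {p q : ℂ} {γ : Set ℂ} {z : ℝ → ℂ}

lemma integrable_logQuotientKernel (hz : IsEquilibriumParametrization p q γ z) :
    Integrable (logQuotientKernel z) (angleMeasure.prod angleMeasure) :=
  ((integrable_arcLogKernel hz).sub integrable_log_cos_sub_cos).congr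
    (logQuotientKernel_ae_eq hz.2.1).symm

lemma arcGrunskyCoeff_eq_cosCoeff (hz : IsEquilibriumParametrization p q γ z) (k l : ℕ+) :
    arcGrunskyCoeff z k l = -2 * cosCoeff (logQuotientKernel z) k l := by
  rw [cosCoeff_eq_integral_integral (integrable_logQuotientKernel hz), arcGrunskyCoeff,
    div_eq_mul_inv, ← neg_mul, mul_assoc]
  rfl

lemma eq_arcGrunskyCoeff (hz : IsEquilibriumParametrization p q γ z) {a : ℕ+ → ℕ+ → ℝ}
    (ha : IsArcGrunskyExpansion γ z a) (k l : ℕ+) : a k l = arcGrunskyCoeff z k l := by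
  obtain ⟨S, hS, hlog⟩ := ha
  have hQ := integrable_logQuotientKernel hz
  have hcoeff := cosCoeff_eq_of_uniform_limit (a := fun ij => -2 * a ij.1 ij.2)
    (hQ.sub (integrable_const (Real.log (2 * logCapacity γ)))) (fun ε hε => ?_) (k, l)
  · rw [cosCoeff_sub hQ (integrable_const _), cosCoeff_const _ k.ne_zero] at hcoeff
    rw [arcGrunskyCoeff_eq_cosCoeff hz]
    linarith
  filter_upwards [Metric.tendstoUniformlyOn_iff.1 hS.tendstoUniformlyOn (ε / 2) (half_pos hε)]
    with F hF
  filter_upwards [ae_cos_ne_cos] with p hp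
  have hclose := hF (Real.cos p.1, Real.cos p.2)
    ⟨Real.cos_mem_Icc p.1, Real.cos_mem_Icc p.2, hp⟩
  simp only [Real.dist_eq, Polynomial.Chebyshev.T_real_cos, Int.cast_natCast,
    mul_assoc (a _ _)] at hclose
  have hquot : logQuotientKernel z p =
      Real.log (2 * logCapacity γ) - 2 * S (Real.cos p.1, Real.cos p.2) :=
    hlog _ (Real.cos_mem_Icc p.1) _ (Real.cos_mem_Icc p.2) hp
  simp only [Pi.sub_apply, hquot, mul_assoc (-2 : ℝ), ← Finset.mul_sum]
  rw [abs_lt] at hclose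
  rw [abs_le]
  constructor <;> linarith

lemma arcGrunskyMatrix_symm (hz : IsEquilibriumParametrization p q γ z) (k l : ℕ+) :
    arcGrunskyMatrix z k l = arcGrunskyMatrix z l k := by
  rw [arcGrunskyMatrix, arcGrunskyMatrix, arcGrunskyCoeff_eq_cosCoeff hz,
    arcGrunskyCoeff_eq_cosCoeff hz, ← cosCoeff_swap, logQuotientKernel_swap, mul_comm ((k : ℕ) : ℝ)]

/-- The cosines diagonalize the logarithmic kernel of the segment, which thereby cancels against the
identity matrix. -/
lemma one_add_arcGrunskyMatrix_apply (hz : IsEquilibriumParametrization p q γ z) (k l : ℕ+) :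
    (1 + Matrix.of (arcGrunskyMatrix z)) k l =
      -2 * (Real.sqrt (k : ℕ) * Real.sqrt (l : ℕ) * cosCoeff (arcLogKernel z) k l) := by
  rw [Matrix.add_apply, Matrix.of_apply, arcGrunskyMatrix, arcGrunskyCoeff_eq_cosCoeff hz,
    cosCoeff_congr_ae (logQuotientKernel_ae_eq hz.2.1),
    cosCoeff_sub (integrable_arcLogKernel hz) integrable_log_cos_sub_cos,
    cosCoeff_log_cos_sub_cos k.ne_zero l.ne_zero, Real.sqrt_mul (Nat.cast_nonneg _),
    Matrix.one_apply]
  simp only [PNat.coe_inj]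
  split_ifs with hkl
  · have hk : ((k : ℕ) : ℝ) ≠ 0 := Nat.cast_ne_zero.2 k.ne_zero
    rw [← hkl, Real.mul_self_sqrt (Nat.cast_nonneg _)]
    field_simp
    ring
  · ring

theorem posSemidef_one_add_arcGrunskyMatrix (hz : IsEquilibriumParametrization p q γ z) :
    (1 + Matrix.of (arcGrunskyMatrix z)).PosSemidef := by
  refine ⟨Matrix.isHermitian_one.add (Matrix.IsHermitian.ext fun k l => ?_), fun x => ?_⟩
  · exact arcGrunskyMatrix_symm hz l k
  let f : ℝ → ℝ := fun θ => ∑ k ∈ x.support, x k * Real.sqrt (k : ℕ) * Real.cos ((k : ℕ) * θ)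
  have hcos (k : ℕ+) : Integrable (fun θ => x k * Real.sqrt (k : ℕ) * Real.cos ((k : ℕ) * θ))
      angleMeasure :=
    integrable_angleMeasure ((by fun_prop : Continuous _).intervalIntegrable _ _)
  have hf0 : ∫ θ, f θ ∂angleMeasure = 0 := by
    rw [integral_finsetSum _ fun k _ => hcos k]
    refine Finset.sum_eq_zero fun k _ => ?_
    rw [integral_const_mul, integral_angleMeasure, integral_cos_nat_mul_zero_pi k.ne_zero, mul_zero,
      mul_zero]
  have hK := integrable_arcLogKernel hz
  have henergy : ∑ k ∈ x.support, ∑ l ∈ x.support, x k * Real.sqrt (k : ℕ) *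
      (x l * Real.sqrt (l : ℕ)) * cosCoeff (arcLogKernel z) k l ≤ 0 := by
    rw [← integral_sum_cos_mul_sum_cos_mul x.support (fun k : ℕ+ => (k : ℕ))
      (fun k => x k * Real.sqrt (k : ℕ)) hK]
    exact integral_mul_mul_log_norm_sub_nonpos (continuous_comp_cos hz.1).measurable
      (integrable_finsetSum _ fun k _ => hcos k) hf0 (ae_comp_cos_ne hz.2.1)
      (integrable_sum_cos_mul_sum_cos_mul _ _ _ hK)
  have hform : (x.sum fun k a => x.sum fun l b =>
      star a * (1 + Matrix.of (arcGrunskyMatrix z)) k l * b) =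
      -2 * ∑ k ∈ x.support, ∑ l ∈ x.support, x k * Real.sqrt (k : ℕ) *
        (x l * Real.sqrt (l : ℕ)) * cosCoeff (arcLogKernel z) k l := by
    simp only [Finsupp.sum, one_add_arcGrunskyMatrix_apply hz, Finset.mul_sum, star_trivial]
    exact Finset.sum_congr rfl fun k _ => Finset.sum_congr rfl fun l _ => by ring
  rw [hform]
  linarith

end ArcGrunskyCoefficients

section MatrixOperators

open scoped ComplexOrder

variable {ι 𝕜 : Type*} [RCLike 𝕜]

lemma sum_sum_star_mul_mul_nonneg {R : Type*} [Ring R] [StarRing R] [PartialOrder R]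
    {M : Matrix ι ι R} (hM : M.PosSemidef) (F : Finset ι) (x : ι → R) :
    0 ≤ ∑ i ∈ F, ∑ j ∈ F, star (x i) * M i j * x j := by
  have h := hM.2 (Finsupp.indicator F fun i _ => x i)
  rwa [Finsupp.sum_indicator_index _ fun i _ => by simp,
    Finset.sum_congr rfl fun i _ => Finsupp.sum_indicator_index _ fun j _ => mul_zero _] at h

lemma posSemidef_map_ofReal {M : Matrix ι ι ℝ} (hM : M.PosSemidef) :
    (M.map fun r => (r : 𝕜)).PosSemidef := by
  have hsymm (i j : ι) : M i j = M j i := by simpa only [star_trivial] using (hM.1.apply i j).symm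
  refine ⟨hM.1.map _ fun r => (RCLike.conj_ofReal r).symm, fun c => ?_⟩
  have hre := sum_sum_star_mul_mul_nonneg hM c.support fun i => RCLike.re (c i)
  have him := sum_sum_star_mul_mul_nonneg hM c.support fun i => RCLike.im (c i)
  rw [RCLike.nonneg_iff, ← RCLike.conj_eq_iff_im]
  simp only [Finsupp.sum, map_sum]
  constructor
  · simpa [Finset.sum_add_distrib] using add_nonneg hre him
  · rw [Finset.sum_comm]
    refine Finset.sum_congr rfl fun i _ => Finset.sum_congr rfl fun j _ => ?_
    rw [Matrix.map_apply, Matrix.map_apply, map_mul, map_mul, RCLike.conj_ofReal, hsymm j i,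
      ← starRingEnd_apply, ← starRingEnd_apply, RCLike.conj_conj]
    ring

/-- The linear operator `B` on `ℓ²(ι)` is multiplication by the matrix `A`; the series defining
`B x` are required to converge for every `x` in `ℓ²(ι)`. -/
def ActsByMatrix (A : Matrix ι ι 𝕜)
    (B : lp (fun _ : ι => 𝕜) 2 →ₗ[𝕜] lp (fun _ : ι => 𝕜) 2) : Prop :=
  ∀ x k, HasSum (fun l => A k l * x l) (B x k)

namespace ActsByMatrix

variable {A : Matrix ι ι 𝕜} {B : lp (fun _ : ι => 𝕜) 2 →ₗ[𝕜] lp (fun _ : ι => 𝕜) 2}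

lemma id_add [DecidableEq ι] (hB : ActsByMatrix A B) :
    ActsByMatrix (1 + A) (LinearMap.id + B) := fun x k => by
  have hone : HasSum (fun l => (1 : Matrix ι ι 𝕜) k l * x l) (x k) := by
    simpa only [Matrix.one_apply_eq, one_mul] using
      hasSum_single (f := fun l => (1 : Matrix ι ι 𝕜) k l * x l) k fun l hl => by
        rw [Matrix.one_apply_ne' hl, zero_mul]
  simp only [Matrix.add_apply, add_mul]
  exact hone.add (hB x k)

lemma apply_single [DecidableEq ι] (hB : ActsByMatrix A B) (l : ι) (c : 𝕜) (k : ι) :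
    B (lp.single 2 l c) k = A k l * c := by
  refine (hB _ k).unique ?_
  simpa only [lp.single_apply_self] using
    hasSum_single (f := fun j => A k j * (lp.single 2 l c : lp (fun _ : ι => 𝕜) 2) j) l
      fun j hj => by rw [lp.single_apply_ne _ _ _ hj, mul_zero]

lemma inner_apply_single [DecidableEq ι] (hB : ActsByMatrix A B) (hA : A.IsHermitian)
    (x : lp (fun _ : ι => 𝕜) 2) (k : ι) (c : 𝕜) :
    inner 𝕜 x (B (lp.single 2 k c)) = inner 𝕜 (B x) (lp.single 2 k c) := by
  refine (lp.hasSum_inner x _).unique ?_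
  rw [lp.inner_single_right, RCLike.inner_apply']
  refine (((RCLike.hasSum_conj' 𝕜).2 (hB x k)).mul_right c).congr_fun fun l => ?_
  rw [hB.apply_single, RCLike.inner_apply', map_mul, starRingEnd_apply (A k l), hA.apply]
  ring

/-- As in the Hellinger–Toeplitz theorem, the coordinates of `B x` are inner products of `x` with
fixed vectors, so that `B` has a closed graph. -/
lemma continuous (hB : ActsByMatrix A B) (hA : A.IsHermitian) : Continuous B := by
  classical
  have hcoord (k : ι) (x : lp (fun _ : ι => 𝕜) 2) :
      inner 𝕜 x (B (lp.single 2 k 1)) = star (B x k) := by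
    rw [hB.inner_apply_single hA, lp.inner_single_right, RCLike.inner_apply', mul_one,
      starRingEnd_apply]
  refine B.continuous_of_seq_closed_graph fun u x y hu hBu => lp.ext (funext fun k => ?_)
  have hstar : Tendsto (fun n => star (B (u n) k)) atTop (𝓝 (star (B x k))) := by
    simpa only [hcoord] using
      hu.inner (𝕜 := 𝕜) (tendsto_const_nhds (x := B (lp.single 2 k 1)))
  have hBux : Tendsto (fun n => B (u n) k) atTop (𝓝 (B x k)) := by
    simpa only [star_star] using hstar.star
  exact tendsto_nhds_unique
    (((lp.evalCLM 𝕜 (fun _ : ι => 𝕜) 2 k).continuous.tendsto y).comp hBu) hBux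

lemma isSymmetric (hB : ActsByMatrix A B) (hA : A.IsHermitian) : B.IsSymmetric := by
  classical
  intro x y
  have hy : HasSum (fun i => lp.single 2 i (y i)) y := lp.hasSum_single ENNReal.ofNat_ne_top y
  have hBxy := hy.mapL (innerSL 𝕜 (B x))
  have hxBy := (hy.mapL ⟨B, hB.continuous hA⟩).mapL (innerSL 𝕜 x)
  simp only [innerSL_apply_apply, ContinuousLinearMap.coe_mk', hB.inner_apply_single hA]
    at hBxy hxBy
  exact hBxy.unique hxBy

lemma inner_sum_single_apply [DecidableEq ι] (hB : ActsByMatrix A B) (F : Finset ι)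
    (x : ι → 𝕜) :
    inner 𝕜 (∑ i ∈ F, lp.single 2 i (x i)) (B (∑ i ∈ F, lp.single 2 i (x i))) =
      ∑ i ∈ F, ∑ j ∈ F, star (x i) * A i j * x j := by
  simp only [map_sum, sum_inner, inner_sum, lp.inner_single_left, hB.apply_single,
    RCLike.inner_apply', mul_assoc]
  exact Finset.sum_comm

lemma isPositive (hB : ActsByMatrix A B) (hA : A.PosSemidef) : B.IsPositive := by
  classical
  have hsymm := hB.isSymmetric hA.1
  refine ⟨hsymm, fun x => ?_⟩
  have hx : Tendsto (fun F : Finset ι => ∑ i ∈ F, lp.single 2 i (x i)) atTop (𝓝 x) :=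
    lp.hasSum_single ENNReal.ofNat_ne_top x
  rw [hsymm x x]
  refine ge_of_tendsto' ((RCLike.continuous_re.tendsto _).comp
    (hx.inner (((hB.continuous hA.1).tendsto x).comp hx))) fun F => ?_
  rw [Function.comp_apply, Function.comp_apply, hB.inner_sum_single_apply]
  exact (RCLike.nonneg_iff.1 (sum_sum_star_mul_mul_nonneg hA F x)).1

end ActsByMatrix

lemma exists_real_ge_of_hasEigenvalue {E : Type*} [NormedAddCommGroup E] [InnerProductSpace 𝕜 E]
    {T : E →ₗ[𝕜] E} {c : ℝ} (hT : (c : 𝕜) • LinearMap.id ≤ T) {μ : 𝕜}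
    (hμ : Module.End.HasEigenvalue T μ) : ∃ r : ℝ, μ = r ∧ c ≤ r := by
  rw [LinearMap.le_def] at hT
  have hsymm : T.IsSymmetric := by
    simpa only [sub_add_cancel] using
      hT.isSymmetric.add (LinearMap.IsSymmetric.id.smul (RCLike.conj_ofReal c))
  have hμre : (RCLike.re μ : 𝕜) = μ := RCLike.conj_eq_iff_re.1 (hsymm.conj_eigenvalue_eq_self hμ)
  refine ⟨RCLike.re μ, hμre.symm, sub_nonneg.1 ?_⟩
  refine eigenvalue_nonneg_of_nonneg (T := T - (c : 𝕜) • LinearMap.id) ?_ hT.re_inner_nonneg_right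
  rw [RCLike.ofReal_sub, hμre]
  exact Module.End.hasEigenvalue_sub_iff.2 (by rwa [sub_add_cancel])

end MatrixOperators

theorem neg_id_le_of_isArcGrunskyOperator {𝕜 : Type*} [RCLike 𝕜] {p q : ℂ} {γ : Set ℂ} {z : ℝ → ℂ}
    (hz : IsEquilibriumParametrization p q γ z)
    {B : lp (fun _ : ℕ+ => 𝕜) 2 →ₗ[𝕜] lp (fun _ : ℕ+ => 𝕜) 2} (hB : IsArcGrunskyOperator z B) :
    -LinearMap.id ≤ B := by
  have hmatrix : ActsByMatrix ((Matrix.of (arcGrunskyMatrix z)).map fun r => (r : 𝕜)) B := hB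
  have hpos := posSemidef_map_ofReal (𝕜 := 𝕜) (posSemidef_one_add_arcGrunskyMatrix hz)
  rw [Matrix.map_add _ RCLike.ofReal_add, Matrix.map_one _ RCLike.ofReal_zero RCLike.ofReal_one]
    at hpos
  rw [LinearMap.le_def, sub_neg_eq_add, add_comm]
  exact hmatrix.id_add.isPositive hpos

end ArcGrunsky

theorem mainTheorem8_general {𝕜 : Type*} [RCLike 𝕜] {p q : ℂ} {γ : Set ℂ} {z : ℝ → ℂ}
    (hz : ArcGrunsky.IsEquilibriumParametrization p q γ z) :
    (∀ a : ℕ+ → ℕ+ → ℝ, ArcGrunsky.IsArcGrunskyExpansion γ z a →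
      ∀ k l : ℕ+, a k l = ArcGrunsky.arcGrunskyCoeff z k l) ∧
    (∀ x : ℕ+ →₀ ℝ,
      0 ≤ ∑ k ∈ x.support, ∑ l ∈ x.support,
        ((if k = l then 1 else 0) + ArcGrunsky.arcGrunskyMatrix z k l) * x k * x l) ∧
    (∀ B : lp (fun _ : ℕ+ => 𝕜) 2 →ₗ[𝕜] lp (fun _ : ℕ+ => 𝕜) 2,
      ArcGrunsky.IsArcGrunskyOperator z B →
        -LinearMap.id ≤ B ∧
        ∀ μ : 𝕜, Module.End.HasEigenvalue B μ →
          ∃ r : ℝ, μ = (r : 𝕜) ∧ -1 ≤ r) := by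
  refine ⟨fun a ha => ArcGrunsky.eq_arcGrunskyCoeff hz ha, fun x => ?_, fun B hB => ?_⟩
  · refine (ArcGrunsky.sum_sum_star_mul_mul_nonneg
      (ArcGrunsky.posSemidef_one_add_arcGrunskyMatrix hz) x.support x).trans_eq
      (Finset.sum_congr rfl fun k _ => Finset.sum_congr rfl fun l _ => ?_)
    rw [star_trivial, Matrix.add_apply, Matrix.one_apply, Matrix.of_apply, mul_comm (x k)]
  · have hle := ArcGrunsky.neg_id_le_of_isArcGrunskyOperator hz hB
    refine ⟨hle, fun μ hμ => ArcGrunsky.exists_real_ge_of_hasEigenvalue ?_ hμ⟩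
    rwa [RCLike.ofReal_neg, RCLike.ofReal_one, neg_one_smul]

theorem mainTheorem8 {𝕜 : Type*} [RCLike 𝕜] {α : ℝ} (hα : 0 < α) {p q : ℂ} {γ : Set ℂ}
    (hγ : ArcGrunsky.IsHolderJordanArc 3 α p q γ) {z : ℝ → ℂ}
    (hz : ArcGrunsky.IsEquilibriumParametrization p q γ z) :
    -- the coefficients of the arc-Grunsky expansion are the entries used below
    (∀ a : ℕ+ → ℕ+ → ℝ, ArcGrunsky.IsArcGrunskyExpansion γ z a →
      ∀ k l : ℕ+, a k l = ArcGrunsky.arcGrunskyCoeff z k l) ∧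
    -- `B ≥ -I` as a quadratic form on finitely supported sequences
    (∀ x : ℕ+ →₀ ℝ,
      0 ≤ ∑ k ∈ x.support, ∑ l ∈ x.support,
        ((if k = l then 1 else 0) + ArcGrunsky.arcGrunskyMatrix z k l) * x k * x l) ∧
    -- `B ≥ -I` for the operator on `ℓ²`, and all its eigenvalues are real and at least `-1`
    (∀ B : lp (fun _ : ℕ+ => 𝕜) 2 →ₗ[𝕜] lp (fun _ : ℕ+ => 𝕜) 2,
      ArcGrunsky.IsArcGrunskyOperator z B →
        -LinearMap.id ≤ B ∧
        ∀ μ : 𝕜, Module.End.HasEigenvalue B μ →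
          ∃ r : ℝ, μ = (r : 𝕜) ∧ -1 ≤ r) :=
  mainTheorem8_general hz
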